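/- Write a permutation $\pi\in S_n$ as the word $\pi(1)\pi(2)\cdots\pi(n)$; a pair $(i,j)$ is an inversion of $\pi$ if $i<j$ and $\pi^{-1}(i)>\pi^{-1}(j)$. Let $D(\pi)$ be the digraph on $\{1,\dots,n\}$ whose arcs are the inversions of $\pi$, and $G(\pi)$ its underlying undirected graph. A digraph $D$ represents $\sigma\in S_n$ if $D\cong D(\sigma)$; $-D$ denotes $D$ with all arcs reversed. Geo-equivalence. Fix points $a\neq b$ in the plane and, on one side of the line $ab$, $n$ rays from each of $a$ and $b$, each ray from $a$ meeting each ray from $b$, listed from each of the two points by increasing angle with the segment $ab$ (and generic: intersection points of three distinct rays from $a$ with three distinct rays from $b$, paired up, are never collinear). Label the rays from $b$ consecutively $1,\dots,n$ and those from $a$ consecutively $\pi(1),\dots,\pi(n)$, and put vertex $i$ at the intersection of the two rays labelled $i$; joining $a$ and $b$ to all vertices $i$ by segments gives a straight line drawing $\overline K_{2,n}(\pi)$ of $K_{2,n}$. Permutations $\sigma,\pi\in S_n$ are geo-equivalent if some bijection between the vertex sets of $\overline K_{2,n}(\sigma)$ and $\overline K_{2,n}(\pi)$ preserves and reflects both adjacency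 and crossings of edges; $[\pi]$ is the geo-equivalence class of $\pi$. Modular decomposition. A module of a graph $G$ is a set $M$ of vertices such that every vertex outside $M$ is adjacent to all vertices of $M$ or to none of them. It is strong if there is no module $N$ such that $M\cap N$, $M\setminus N$ and $N\setminus M$ are all non-empty. The non-empty strong modules are the nodes of the modular decomposition tree of $G$; those with at least two vertices are its internal nodes. An internal node $M$ is a degenerate $0$-node if the induced subgraph $G|M$ is disconnected, a degenerate $1$-node if $G|M$ is connected but $G^c|M$ is disconnected, and prime if both are connected. The children of a degenerate $0$-node $M$ are the vertex sets of the connected components of $G|M$. A cograph is a graph whose modular decomposition tree has no prime node. **Statement.** Let $\pi\in S_n$ be such that $G=G(\pi)$ is a cograph, and let $D=D(\pi)$. Let $M_1,\dots,M_r$ be the degenerate $0$-nodes of the modular decomposition tree of $G$. Suppose that $M_i$ has $k_i$ children, which are divided into isomorphism classes according to the directed subgraphs that they induce in $D$, and let $n_{i1},n_{i2},\dots,n_{it_i}$ be the sizes of these classes. Then the number of permutations in $S_n$ represented by $D$ is $$n(D)=\prod_{i=1}^{r}\frac{k_i!}{n_{i1}!\,n_{i2}!\cdots n_{it_i}!}.$$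 The geo-equivalence class $[\pi]$ has exactly $2\,n(D)$ elements if $D\not\cong -D$, and exactly $n(D)$ elements if $D\cong -D$. -/

import Mathlib

open scoped Nat

namespace GeoPerm

/-! ### Geometric graphs and geo-isomorphism -/

/-- A geometric graph: a simple graph with a straight line drawing in the plane, the vertices in
general position (distinct, no three collinear) and no three edges crossing at a single point. -/
structure GeometricGraph (V : Type*) where
  graph : SimpleGraph V
  pos : V → ℝ × ℝ
  pos_injective : Function.Injective pos
  not_collinear : ∀ u v w : V, u ≠ v → u ≠ w → v ≠ w → ¬ Collinear ℝ {pos u, pos v, pos w}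
  no_triple_crossing : ∀ u₁ v₁ u₂ v₂ u₃ v₃ : V,
    graph.Adj u₁ v₁ → graph.Adj u₂ v₂ → graph.Adj u₃ v₃ →
    s(u₁, v₁) ≠ s(u₂, v₂) → s(u₁, v₁) ≠ s(u₃, v₃) → s(u₂, v₂) ≠ s(u₃, v₃) →
    ¬ ∃ z, z ∈ openSegment ℝ (pos u₁) (pos v₁) ∧ z ∈ openSegment ℝ (pos u₂) (pos v₂) ∧
      z ∈ openSegment ℝ (pos u₃) (pos v₃)

/-- `xy` crosses `uv`: they are distinct edges whose drawings share an interior point. -/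
def GeometricGraph.Crosses {V : Type*} (G : GeometricGraph V) (x y u v : V) : Prop :=
  G.graph.Adj x y ∧ G.graph.Adj u v ∧ s(x, y) ≠ s(u, v) ∧
    (openSegment ℝ (G.pos x) (G.pos y) ∩ openSegment ℝ (G.pos u) (G.pos v)).Nonempty

/-- A geo-isomorphism: a vertex bijection preserving and reflecting adjacency and crossings. -/
structure GeoIso {V W : Type*} (G : GeometricGraph V) (H : GeometricGraph W) extends V ≃ W where
  adj_iff : ∀ u v, G.graph.Adj u v ↔ H.graph.Adj (toEquiv u) (toEquiv v)
  crosses_iff : ∀ x y u v, G.Crosses x y u v ↔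
    H.Crosses (toEquiv x) (toEquiv y) (toEquiv u) (toEquiv v)

/-! ### The realization of `K_{2,n}` given by a permutation -/

/-- The intersection of the ray from `a = (0, 0)` with direction `(p, 1)` and the ray from
`b = (1, 0)` with direction `(-q, 1)`. -/
noncomputable def rayMeet (p q : ℝ) : ℝ × ℝ := (p / (p + q), 1 / (p + q))

/-- A template: from each of `a = (0, 0)` and `b = (1, 0)`, `n` rays into the upper half plane.
The `k`-th ray from `a` has direction `(p k, 1)` and the `i`-th ray from `b` has direction
`(-q i, 1)`, so that `p k` and `q i` are the cotangents of the angles that the rays make with the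
segment `ab`.  The rays are listed in order of increasing angle, every ray from `a` meets every ray
from `b`, and vertices placed at intersections on pairwise different rays are never collinear. -/
structure Template (n : ℕ) where
  p : Fin n → ℝ
  q : Fin n → ℝ
  p_strictAnti : StrictAnti p
  q_strictAnti : StrictAnti q
  meet : ∀ k i, 0 < p k + q i
  generic : ∀ k₁ k₂ k₃ i₁ i₂ i₃ : Fin n, k₁ ≠ k₂ → k₁ ≠ k₃ → k₂ ≠ k₃ → i₁ ≠ i₂ → i₁ ≠ i₃ → i₂ ≠ i₃ →
    ¬ Collinear ℝ {rayMeet (p k₁) (q i₁), rayMeet (p k₂) (q i₂), rayMeet (p k₃) (q i₃)}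

theorem det_eq_of_collinear {x y z : ℝ × ℝ} (h : Collinear ℝ {x, y, z}) :
    (y.1 - x.1) * (z.2 - x.2) = (z.1 - x.1) * (y.2 - x.2) := by
  obtain ⟨v, hv⟩ := (collinear_iff_of_mem (p₀ := x) (by simp)).1 h
  obtain ⟨r, hr⟩ := hv y (by simp)
  obtain ⟨s, hs⟩ := hv z (by simp)
  subst hr hs
  simp
  ring

theorem det_eq_of_collinear_rayMeet {p₁ p₂ p₃ q₁ q₂ q₃ : ℝ}
    (h₁ : 0 < p₁ + q₁) (h₂ : 0 < p₂ + q₂) (h₃ : 0 < p₃ + q₃)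
    (h : Collinear ℝ {rayMeet p₁ q₁, rayMeet p₂ q₂, rayMeet p₃ q₃}) :
    (p₁ - p₃) * (q₂ - q₃) = (p₂ - p₃) * (q₁ - q₃) := by
  have h := det_eq_of_collinear h
  simp only [rayMeet] at h
  field_simp at h
  have h' : (p₁ + q₁) * ((p₁ - p₃) * (q₂ - q₃) - (p₂ - p₃) * (q₁ - q₃)) = 0 := by
    linear_combination -h
  rcases mul_eq_zero.1 h' with h' | h'
  · exact absurd h' h₁.ne'
  · linarith

theorem template_aux {n k₁ k₂ k₃ i₁ i₂ i₃ : ℕ} (hk₁ : k₁ < n) (hk₂ : k₂ < n) (hk : k₁ ≠ k₂)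
    (hi₃ : i₃ < n) (h₁ : i₁ < i₃) (h₂ : i₂ < i₃) :
    ((n - k₁ : ℝ) - (n - k₃)) * (((n : ℝ) + 1) ^ (n - i₂) - ((n : ℝ) + 1) ^ (n - i₃)) ≠
    ((n - k₂ : ℝ) - (n - k₃)) * (((n : ℝ) + 1) ^ (n - i₁) - ((n : ℝ) + 1) ^ (n - i₃)) := by
  intro h
  obtain ⟨d, hd⟩ : ∃ d, n - i₁ = (n - i₃) + (d + 1) := ⟨i₃ - i₁ - 1, by omega⟩
  obtain ⟨e, he⟩ : ∃ e, n - i₂ = (n - i₃) + (e + 1) := ⟨i₃ - i₂ - 1, by omega⟩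
  rw [hd, he, pow_add _ _ (d + 1), pow_add _ _ (e + 1)] at h
  have hB : ((n : ℝ) + 1) ^ (n - i₃) ≠ 0 := by positivity
  have h' : ((k₃ : ℝ) - k₁) * (((n : ℝ) + 1) ^ (e + 1) - 1) =
      ((k₃ : ℝ) - k₂) * (((n : ℝ) + 1) ^ (d + 1) - 1) := by
    apply mul_left_cancel₀ hB
    linear_combination h
  have h'' : ((k₃ : ℤ) - k₁) * (((n : ℤ) + 1) ^ (e + 1) - 1) =
      ((k₃ : ℤ) - k₂) * (((n : ℤ) + 1) ^ (d + 1) - 1) := by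
    exact_mod_cast h'
  have hdvd : ((n : ℤ) + 1) ∣ (k₂ : ℤ) - k₁ :=
    ⟨((k₃ : ℤ) - k₁) * ((n : ℤ) + 1) ^ e - ((k₃ : ℤ) - k₂) * ((n : ℤ) + 1) ^ d, by
      rw [pow_succ, pow_succ] at h''
      linear_combination -h''⟩
  have := Int.eq_zero_of_abs_lt_dvd hdvd (by rw [abs_lt]; constructor <;> omega)
  omega

/-- Templates exist for every `n`. -/
theorem template_nonempty (n : ℕ) : Nonempty (Template n) := by
  have meet : ∀ k i : Fin n, (0 : ℝ) < (n - (k : ℕ)) + ((n : ℝ) + 1) ^ (n - (i : ℕ)) := by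
    intro k i
    have : ((k : ℕ) : ℝ) < n := by exact_mod_cast k.2
    have h2 : 0 < ((n : ℝ) + 1) ^ (n - (i : ℕ)) := by positivity
    linarith
  refine ⟨⟨fun k => (n : ℝ) - (k : ℕ), fun i => ((n : ℝ) + 1) ^ (n - (i : ℕ)), ?_, ?_, meet, ?_⟩⟩
  · intro k l h
    have : ((k : ℕ) : ℝ) < (l : ℕ) := by exact_mod_cast h
    simpa using this
  · intro i j h
    have hn : 0 < (n : ℝ) := by
      have := i.pos
      exact_mod_cast this
    have h' : (i : ℕ) < j := h
    exact pow_lt_pow_right₀ (by linarith) (by omega)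
  · intro k₁ k₂ k₃ i₁ i₂ i₃ k₁₂ k₁₃ k₂₃ i₁₂ i₁₃ i₂₃ h
    have h := det_eq_of_collinear_rayMeet (meet _ _) (meet _ _) (meet _ _) h
    have hk₁ := k₁.2
    have hk₂ := k₂.2
    have hk₃ := k₃.2
    have hi₁ := i₁.2
    have hi₂ := i₂.2
    have hi₃ := i₃.2
    rw [Ne, Fin.ext_iff] at k₁₂ k₁₃ k₂₃ i₁₂ i₁₃ i₂₃
    have hmax : ((i₁ : ℕ) < i₃ ∧ (i₂ : ℕ) < i₃) ∨ ((i₁ : ℕ) < i₂ ∧ (i₃ : ℕ) < i₂) ∨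
        ((i₂ : ℕ) < i₁ ∧ (i₃ : ℕ) < i₁) := by omega
    rcases hmax with ⟨ha, hb⟩ | ⟨ha, hb⟩ | ⟨ha, hb⟩
    · exact template_aux (k₃ := k₃) hk₁ hk₂ k₁₂ hi₃ ha hb h
    · refine template_aux (k₃ := k₂) hk₁ hk₃ k₁₃ hi₂ ha hb ?_
      linear_combination -h
    · refine template_aux (k₃ := k₁) hk₂ hk₃ k₂₃ hi₁ ha hb ?_
      linear_combination h

section Realization

variable {n : ℕ} (T : Template n) (π : Equiv.Perm (Fin n))

/-- The position of the vertices of `K_{2,n}`: the side `{a, b}` is `Fin 2` and the other side is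
`Fin n`.  The rays from `b` are labelled consecutively and the rays from `a` are labelled
`π 0, π 1, …`; so vertex `i` lies on the `i`-th ray from `b` and on the `π⁻¹ i`-th ray from `a`. -/
noncomputable def vertexPos : Fin 2 ⊕ Fin n → ℝ × ℝ
  | Sum.inl u => ((u : ℕ), 0)
  | Sum.inr i => rayMeet (T.p (π⁻¹ i)) (T.q i)

theorem vertexPos_inr (i : Fin n) :
    0 < (vertexPos T π (Sum.inr i)).2 ∧
    (vertexPos T π (Sum.inr i)).1 = T.p (π⁻¹ i) * (vertexPos T π (Sum.inr i)).2 ∧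
    1 - (vertexPos T π (Sum.inr i)).1 = T.q i * (vertexPos T π (Sum.inr i)).2 := by
  have h := T.meet (π⁻¹ i) i
  simp only [vertexPos, rayMeet]
  refine ⟨by positivity, by field_simp, ?_⟩
  field_simp
  ring

theorem eq_of_prop (u : Fin 2) {i j : Fin n}
    (h : ((vertexPos T π (Sum.inr i)).1 - (u : ℕ)) * (vertexPos T π (Sum.inr j)).2 =
      ((vertexPos T π (Sum.inr j)).1 - (u : ℕ)) * (vertexPos T π (Sum.inr i)).2) : i = j := by
  obtain ⟨yi, ai, bi⟩ := vertexPos_inr T π i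
  obtain ⟨yj, aj, bj⟩ := vertexPos_inr T π j
  have hy := mul_pos yi yj
  fin_cases u
  · apply (π⁻¹).injective
    apply T.p_strictAnti.injective
    apply mul_right_cancel₀ hy.ne'
    simp only [Nat.cast_zero, sub_zero] at h
    rw [ai, aj] at h
    linear_combination h
  · apply T.q_strictAnti.injective
    apply mul_right_cancel₀ hy.ne'
    simp only [Nat.cast_one] at h
    linear_combination -h - (vertexPos T π (Sum.inr j)).2 * bi + (vertexPos T π (Sum.inr i)).2 * bj

/-- The realization of `K_{2,n}` drawn on the template `T` according to `π`. -/
noncomputable def realization : GeometricGraph (Fin 2 ⊕ Fin n) where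
  graph := completeBipartiteGraph (Fin 2) (Fin n)
  pos := vertexPos T π
  pos_injective := by
    rintro (u | i) (v | j) h
    · have h1 := congrArg Prod.fst h
      simp only [vertexPos, Nat.cast_inj] at h1
      rw [Fin.ext h1]
    · have h1 := congrArg Prod.snd h
      have := (vertexPos_inr T π j).1
      rw [← h1] at this
      simp [vertexPos] at this
    · have h1 := congrArg Prod.snd h
      have := (vertexPos_inr T π i).1
      rw [h1] at this
      simp [vertexPos] at this
    · rw [eq_of_prop T π 0 (i := i) (j := j) (by rw [h])]
  not_collinear := by
    have two : ∀ u v : Fin 2, u ≠ v → ((u : ℕ) : ℝ) - (v : ℕ) ≠ 0 := by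
      intro u v h h'
      apply h
      rw [sub_eq_zero] at h'
      exact Fin.ext (by exact_mod_cast h')
    have hl : ∀ u, (vertexPos T π (Sum.inl u)).1 = (u : ℕ) := fun _ => rfl
    have hl' : ∀ u, (vertexPos T π (Sum.inl u)).2 = 0 := fun _ => rfl
    intro u v w huv huw hvw h
    have hd := det_eq_of_collinear h
    rcases u with u | i <;> rcases v with v | j <;> rcases w with w | k <;>
      simp only [ne_eq, Sum.inl.injEq, Sum.inr.injEq, hl, hl', sub_zero] at huv huw hvw hd
    · omega
    · have := mul_ne_zero (two _ _ (Ne.symm huv)) (vertexPos_inr T π k).1.ne'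
      apply this
      linear_combination hd
    · have := mul_ne_zero (two _ _ (Ne.symm huw)) (vertexPos_inr T π j).1.ne'
      apply this
      linear_combination -hd
    · exact hvw (eq_of_prop T π u (by linear_combination hd))
    · have := mul_ne_zero (two _ _ hvw) (vertexPos_inr T π i).1.ne'
      apply this
      linear_combination -hd
    · exact huw (eq_of_prop T π v (by linear_combination -hd))
    · exact huv (eq_of_prop T π w (by linear_combination hd))
    · exact T.generic _ _ _ _ _ _ (by simpa using huv) (by simpa using huw) (by simpa using hvw)
        huv huw hvw h
  no_triple_crossing := by
    -- two edges from the same end in `{a, b}` do not meet again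
    have key : ∀ (u : Fin 2) (i j : Fin n) (z : ℝ × ℝ),
        z ∈ openSegment ℝ (vertexPos T π (Sum.inl u)) (vertexPos T π (Sum.inr i)) →
        z ∈ openSegment ℝ (vertexPos T π (Sum.inl u)) (vertexPos T π (Sum.inr j)) → i = j := by
      rintro u i j z ⟨a, b, -, hb, hab, rfl⟩ ⟨c, d, -, hd, hcd, h⟩
      apply eq_of_prop T π u
      have h1 := congrArg Prod.fst h
      have h2 := congrArg Prod.snd h
      have hl : (vertexPos T π (Sum.inl u)).1 = (u : ℕ) := rfl
      have hl' : (vertexPos T π (Sum.inl u)).2 = 0 := rfl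
      simp only [Prod.fst_add, Prod.snd_add, Prod.smul_fst, Prod.smul_snd, smul_eq_mul, hl, hl',
        mul_zero, zero_add] at h1 h2
      obtain rfl : a = 1 - b := by linarith
      obtain rfl : c = 1 - d := by linarith
      apply mul_left_cancel₀ (mul_pos hb hd).ne'
      linear_combination (b * ((vertexPos T π (Sum.inr i)).1 - (u : ℕ))) * h2 -
        (b * (vertexPos T π (Sum.inr i)).2) * h1
    have norm : ∀ x y : Fin 2 ⊕ Fin n, (completeBipartiteGraph (Fin 2) (Fin n)).Adj x y →
        ∃ (u : Fin 2) (i : Fin n), s(x, y) = s(Sum.inl u, Sum.inr i) ∧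
          openSegment ℝ (vertexPos T π x) (vertexPos T π y) =
          openSegment ℝ (vertexPos T π (Sum.inl u)) (vertexPos T π (Sum.inr i)) := by
      rintro (u | i) (v | j) h
      · simp at h
      · exact ⟨u, j, rfl, rfl⟩
      · exact ⟨v, i, Sym2.eq_swap, openSegment_symm _ _ _⟩
      · simp at h
    rintro x₁ y₁ x₂ y₂ x₃ y₃ h₁ h₂ h₃ h₁₂ h₁₃ h₂₃ ⟨z, z₁, z₂, z₃⟩
    obtain ⟨u₁, i₁, e₁, s₁⟩ := norm _ _ h₁
    obtain ⟨u₂, i₂, e₂, s₂⟩ := norm _ _ h₂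
    obtain ⟨u₃, i₃, e₃, s₃⟩ := norm _ _ h₃
    rw [s₁] at z₁
    rw [s₂] at z₂
    rw [s₃] at z₃
    rw [e₁, e₂] at h₁₂
    rw [e₁, e₃] at h₁₃
    rw [e₂, e₃] at h₂₃
    have hu : u₁ = u₂ ∨ u₁ = u₃ ∨ u₂ = u₃ := by omega
    rcases hu with rfl | rfl | rfl
    · exact h₁₂ (by rw [key _ _ _ z z₁ z₂])
    · exact h₁₃ (by rw [key _ _ _ z z₁ z₃])
    · exact h₂₃ (by rw [key _ _ _ z z₂ z₃])

end Realization

/-- Geo-equivalence `σ ∼ π`: the realizations of `K_{2,n}` given by `σ` and `π` are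
geo-isomorphic. -/
def GeoEquiv {n : ℕ} (T : Template n) (σ π : Equiv.Perm (Fin n)) : Prop :=
  Nonempty (GeoIso (realization T σ) (realization T π))

/-- The geo-equivalence class `[π]`. -/
def geoClass {n : ℕ} (T : Template n) (π : Equiv.Perm (Fin n)) : Set (Equiv.Perm (Fin n)) :=
  {σ | GeoEquiv T σ π}

/-! ### Permutation graphs and permutation digraphs -/

/-- `(i, j)` is an inversion of `π`. -/
def IsInversion {n : ℕ} (π : Equiv.Perm (Fin n)) (i j : Fin n) : Prop :=
  i < j ∧ π⁻¹ j < π⁻¹ i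

/-- The permutation digraph `D(π)`. -/
def permDigraph {n : ℕ} (π : Equiv.Perm (Fin n)) : Digraph (Fin n) where
  Adj := IsInversion π

/-- The permutation graph `G(π)`: `i < j` are adjacent if and only if `(i, j)` is an inversion. -/
def permGraph {n : ℕ} (π : Equiv.Perm (Fin n)) : SimpleGraph (Fin n) :=
  SimpleGraph.fromRel (IsInversion π)

/-- `D ≅ D'` for digraphs. -/
def DigraphIsomorphic {V W : Type*} (D : Digraph V) (D' : Digraph W) : Prop :=
  Nonempty (D.Adj ≃r D'.Adj)

/-- The digraph `-D`. -/
def reverseDigraph {V : Type*} (D : Digraph V) : Digraph V where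
  Adj u v := D.Adj v u

/-- The directed subgraph `D|X` induced by `X`. -/
def inducedDigraph {V : Type*} (D : Digraph V) (X : Set V) : Digraph X where
  Adj u v := D.Adj u v

/-- `D` represents `σ`. -/
def Represents {V : Type*} {n : ℕ} (D : Digraph V) (σ : Equiv.Perm (Fin n)) : Prop :=
  DigraphIsomorphic D (permDigraph σ)

/-! ### Modular decomposition -/

section Modular

variable {V : Type*} (G : SimpleGraph V)

/-- A module: every outside vertex is adjacent to all or to none of its vertices. -/
def IsModule (M : Set V) : Prop :=
  ∀ v, v ∉ M → (∀ u ∈ M, G.Adj u v) ∨ (∀ u ∈ M, ¬ G.Adj u v)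

def Overlap (M N : Set V) : Prop :=
  (M ∩ N).Nonempty ∧ (M \ N).Nonempty ∧ (N \ M).Nonempty

/-- A strong module: a module that overlaps no module. -/
def IsStrongModule (M : Set V) : Prop :=
  IsModule G M ∧ ∀ N, IsModule G N → ¬ Overlap M N

/-- An internal node of the modular decomposition tree, whose nodes are the nonempty strong modules
and whose leaves are the singletons. -/
def IsInternalNode (M : Set V) : Prop :=
  IsStrongModule G M ∧ M.Nontrivial

def IsZeroNode (M : Set V) : Prop :=
  IsInternalNode G M ∧ ¬ (G.induce M).Connected

def IsOneNode (M : Set V) : Prop :=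
  IsInternalNode G M ∧ (G.induce M).Connected ∧ ¬ (Gᶜ.induce M).Connected

def IsPrimeNode (M : Set V) : Prop :=
  IsInternalNode G M ∧ (G.induce M).Connected ∧ (Gᶜ.induce M).Connected

/-- A cograph: there are no prime nodes in the modular decomposition tree. -/
def IsCograph : Prop := ∀ M, ¬ IsPrimeNode G M

/-- The vertex sets of the connected components of `G|M`. -/
def componentsIn (M : Set V) : Set (Set V) :=
  {X | ∃ c : (G.induce M).ConnectedComponent, X = Subtype.val '' c.supp}

/-- `X` is a child of the node `M` in the modular decomposition tree: a connected component of
`G|M` if `M` is a degenerate 0-node, a connected component of `Gᶜ|M` if `M` is a degenerate 1-node,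
and a maximal proper submodule of `M` if `M` is a prime node. -/
def IsChild (M X : Set V) : Prop :=
  (IsZeroNode G M ∧ X ∈ componentsIn G M) ∨
  (IsOneNode G M ∧ X ∈ componentsIn Gᶜ M) ∨
  (IsPrimeNode G M ∧ Maximal (fun Y => IsModule G Y ∧ Y ⊂ M) X)

/-- The children of `M`. -/
def Child (M : Set V) : Type _ := {X : Set V // IsChild G M X}

/-- The division of the children of `M` into isomorphism types, according to the directed subgraphs
that they induce in `D`. -/
def childSetoid (D : Digraph V) (M : Set V) : Setoid (Child G M) where
  r X Y := DigraphIsomorphic (inducedDigraph D X.1) (inducedDigraph D Y.1)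
  iseqv := ⟨fun _ => ⟨RelIso.refl _⟩, fun ⟨e⟩ => ⟨e.symm⟩, fun ⟨e⟩ ⟨f⟩ => ⟨e.trans f⟩⟩

/-- The factor `k! / (n₁! n₂! ⋯)` of the node `M`, where `k` is the number of children of `M` and
`n₁, n₂, …` are the numbers of children of each isomorphism type. -/
noncomputable def nodeFactor (D : Digraph V) (M : Set V) : ℚ :=
  ((Nat.card (Child G M))! : ℚ) /
    ∏ᶠ t : Quotient (childSetoid G D M), ((Nat.card {X : Child G M // Quotient.mk _ X = t})! : ℚ)

end Modular

end GeoPerm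

/-! An edge from `b` to `i` crosses an edge from `a` to `j` exactly when `(i, j)` is an inversion,
so a geo-isomorphism that keeps the two sides is an isomorphism of `D(σ)` with `D(π)`, or with
`-D(π)` if it exchanges `a` and `b`. Since `D(σ⁻¹) ≅ -D(σ)`, the class `[π]` is the set represented
by `D` together with its set of inverses (`geoClass_eq_union`). These two sets have equal size; they
coincide if `D ≅ -D` and are disjoint otherwise.

To compute `n(D)`, count realizers: pairs of linear orders `(L, M)` such that the arcs of `D` are
the pairs on which `L` agrees with the reverse of `M`. A realizer is the same as a permutation `σ`
with an isomorphism `D ≅ D(σ)`, so `n(D)` is the number of realizers divided by the number of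
automorphisms (`realizerRatio_eq_ncard`). Both counts factor over a modular partition whose blocks
are intervals in every realizer and are permuted by every automorphism
(`realizerRatio_eq_of_partition`). At a 0-node the quotient has no arcs: it has `k!` realizers, and
`∏ nᵢ!` of its automorphisms lift. At a 1-node the quotient is a linear order, with one realizer and
one automorphism. Induction down the decomposition tree gives the product formula. -/

namespace GeoPerm

/-! ### Geo-equivalence in terms of permutation digraphs -/

section Geo

variable {n : ℕ} (T : Template n)

/-- The ray from `b` through `i` and the ray from `a` through `j` meet at height `1 / (pj + qi)`.
This point is interior to both segments iff it is lower than both vertices, whose heights are `1 /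
(pi + qi)` and `1 / (pj + qj)`; that is, iff `pi < pj` and `qj < qi`. Cotangents decrease along the
listing, which turns this into an inversion. -/
theorem openSegment_inter_nonempty_iff (π : Equiv.Perm (Fin n)) (i j : Fin n) :
    (openSegment ℝ (vertexPos T π (Sum.inl 1)) (vertexPos T π (Sum.inr i)) ∩
      openSegment ℝ (vertexPos T π (Sum.inl 0)) (vertexPos T π (Sum.inr j))).Nonempty ↔
    IsInversion π i j := by
  obtain ⟨yi, ai, bi⟩ := vertexPos_inr T π i
  obtain ⟨yj, aj, bj⟩ := vertexPos_inr T π j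
  have h0 : vertexPos T π (Sum.inl 0) = (0, 0) := by simp [vertexPos]
  have h1 : vertexPos T π (Sum.inl 1) = (1, 0) := by simp [vertexPos]
  rw [h0, h1, IsInversion, ← T.q_strictAnti.lt_iff_gt, ← T.p_strictAnti.lt_iff_gt]
  have hij := T.meet (π⁻¹ j) i
  have hii := T.meet (π⁻¹ i) i
  have hjj := T.meet (π⁻¹ j) j
  generalize vertexPos T π (Sum.inr i) = P at *
  generalize vertexPos T π (Sum.inr j) = Q at *
  generalize T.p (π⁻¹ i) = pi at *
  generalize T.p (π⁻¹ j) = pj at *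
  generalize T.q i = qi at *
  generalize T.q j = qj at *
  obtain ⟨P1, P2⟩ := P
  obtain ⟨Q1, Q2⟩ := Q
  simp only at *
  have eP : (pi + qi) * P2 = 1 := by linear_combination -ai - bi
  have eQ : (pj + qj) * Q2 = 1 := by linear_combination -aj - bj
  constructor
  · rintro ⟨⟨z1, z2⟩, ⟨a, b, ha, hb, hab, h⟩, ⟨c, d, hc, hd, hcd, h'⟩⟩
    simp only [Prod.smul_mk, smul_eq_mul, Prod.mk_add_mk, Prod.mk.injEq, mul_one, mul_zero,
      zero_add] at h h'
    obtain ⟨h1, h2⟩ := h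
    obtain ⟨h3, h4⟩ := h'
    have e : (pj + qi) * z2 = 1 := by
      have : z1 = pj * z2 := by rw [← h3, ← h4, aj]; ring
      have : 1 - z1 = qi * z2 := by
        rw [← h1, ← h2]
        linear_combination -hab + b * bi
      linarith
    have l1 : z2 < P2 := by nlinarith
    have l2 : z2 < Q2 := by nlinarith
    have z0 : 0 < z2 := by nlinarith
    constructor
    · by_contra hcon
      push Not at hcon
      nlinarith
    · by_contra hcon
      push Not at hcon
      nlinarith
  · rintro ⟨hq, hp⟩
    have e : (pj + qi) * (pj + qi)⁻¹ = 1 := mul_inv_cancel₀ hij.ne'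
    have z0 : 0 < (pj + qi)⁻¹ := inv_pos.2 hij
    generalize (pj + qi)⁻¹ = z at e z0
    have l1 : z < P2 := by
      by_contra hcon
      push Not at hcon
      nlinarith
    have l2 : z < Q2 := by
      by_contra hcon
      push Not at hcon
      nlinarith
    -- Both `a` and `b` have height 0, so the weight of the upper end of each segment is a ratio of
    -- heights.
    refine ⟨(pj * z, z), ⟨1 - z / P2, z / P2, ?_, by positivity, by ring, ?_⟩,
      ⟨1 - z / Q2, z / Q2, ?_, by positivity, by ring, ?_⟩⟩
    · rw [sub_pos, div_lt_one yi]; exact l1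
    · simp only [Prod.smul_mk, smul_eq_mul, Prod.mk_add_mk, Prod.mk.injEq, mul_one, mul_zero,
        zero_add]
      refine ⟨?_, by field_simp⟩
      rw [ai]
      field_simp
      linear_combination z * eP - P2 * e
    · rw [sub_pos, div_lt_one yj]; exact l2
    · simp only [Prod.smul_mk, smul_eq_mul, Prod.mk_add_mk, Prod.mk.injEq, mul_zero,
        zero_add]
      refine ⟨?_, by field_simp⟩
      rw [aj]
      field_simp

theorem openSegment_inter_same (π : Equiv.Perm (Fin n)) (u : Fin 2) {i j : Fin n}
    (h : (openSegment ℝ (vertexPos T π (Sum.inl u)) (vertexPos T π (Sum.inr i)) ∩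
      openSegment ℝ (vertexPos T π (Sum.inl u)) (vertexPos T π (Sum.inr j))).Nonempty) :
    i = j := by
  obtain ⟨z, ⟨a, b, -, hb, hab, rfl⟩, ⟨c, d, -, hd, hcd, h⟩⟩ := h
  apply eq_of_prop T π u
  have h1 := congrArg Prod.fst h
  have h2 := congrArg Prod.snd h
  have hl : (vertexPos T π (Sum.inl u)).1 = (u : ℕ) := rfl
  have hl' : (vertexPos T π (Sum.inl u)).2 = 0 := rfl
  simp only [Prod.fst_add, Prod.snd_add, Prod.smul_fst, Prod.smul_snd, smul_eq_mul, hl, hl',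
    mul_zero, zero_add] at h1 h2
  obtain rfl : a = 1 - b := by linarith
  obtain rfl : c = 1 - d := by linarith
  apply mul_left_cancel₀ (mul_pos hb hd).ne'
  linear_combination (b * ((vertexPos T π (Sum.inr i)).1 - (u : ℕ))) * h2 -
    (b * (vertexPos T π (Sum.inr i)).2) * h1

/-- Edges from a common end never cross. For edges from different ends, the arc points from the
vertex joined to `b` to the vertex joined to `a`, so crossings record the orientation of `D(π)`. -/
theorem crosses_inl_inr (π : Equiv.Perm (Fin n)) (u v : Fin 2) (i j : Fin n) :
    (realization T π).Crosses (Sum.inl u) (Sum.inr i) (Sum.inl v) (Sum.inr j) ↔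
    (u = 1 ∧ v = 0 ∧ IsInversion π i j) ∨ (u = 0 ∧ v = 1 ∧ IsInversion π j i) := by
  have hg : (realization T π).graph = completeBipartiteGraph (Fin 2) (Fin n) := rfl
  have hp : (realization T π).pos = vertexPos T π := rfl
  simp only [GeometricGraph.Crosses, hg, hp, completeBipartiteGraph_adj, Sum.isLeft_inl,
    Sum.isRight_inr, Sum.isRight_inl, Sum.isLeft_inr, and_self, true_and, ne_eq,
    Sym2.eq_iff, Sum.inl.injEq, Sum.inr.injEq, reduceCtorEq, or_false]
  have hu : u = 0 ∨ u = 1 := by omega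
  have hv : v = 0 ∨ v = 1 := by omega
  rcases hu with rfl | rfl <;> rcases hv with rfl | rfl
  · simp only [true_and, zero_ne_one, false_and, or_false, iff_false, not_and]
    exact fun h h' => h (openSegment_inter_same T π 0 h')
  · rw [Set.inter_comm, openSegment_inter_nonempty_iff]
    simp
  · rw [openSegment_inter_nonempty_iff]
    simp
  · simp only [true_and, one_ne_zero, false_and, and_false, or_false, iff_false, not_and]
    exact fun h h' => h (openSegment_inter_same T π 1 h')

theorem GeometricGraph.crosses_swap_left {V : Type*} (G : GeometricGraph V) (x y u v : V) :
    G.Crosses x y u v ↔ G.Crosses y x u v := by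
  simp only [GeometricGraph.Crosses, G.graph.adj_comm x y, Sym2.eq_swap (a := x),
    openSegment_symm ℝ (G.pos x)]

theorem GeometricGraph.crosses_swap_right {V : Type*} (G : GeometricGraph V) (x y u v : V) :
    G.Crosses x y u v ↔ G.Crosses x y v u := by
  simp only [GeometricGraph.Crosses, G.graph.adj_comm u v, Sym2.eq_swap (a := u),
    openSegment_symm ℝ (G.pos u)]

/-- A bijection of the vertices that respects the two sides is a geo-isomorphism as soon as it
respects the crossings of edges listed from the side `{a, b}`. -/
theorem geoEquiv_of_sum (σ π : Equiv.Perm (Fin n)) (e : Fin 2 ≃ Fin 2) (f : Fin n ≃ Fin n)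
    (h : ∀ u v i j, (realization T σ).Crosses (Sum.inl u) (Sum.inr i) (Sum.inl v) (Sum.inr j) ↔
      (realization T π).Crosses (Sum.inl (e u)) (Sum.inr (f i)) (Sum.inl (e v)) (Sum.inr (f j))) :
    GeoEquiv T σ π := by
  have hadj : ∀ x y, (realization T σ).graph.Adj x y ↔
      (realization T π).graph.Adj (Equiv.sumCongr e f x) (Equiv.sumCongr e f y) := by
    have hgr : ∀ τ, (realization T τ).graph = completeBipartiteGraph (Fin 2) (Fin n) :=
      fun _ => rfl
    rintro (u | i) (v | j) <;> simp [hgr]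
  refine ⟨⟨Equiv.sumCongr e f, hadj, ?_⟩⟩
  have no : ∀ (τ : Equiv.Perm (Fin n)) x y, x.isLeft = y.isLeft →
      ¬ (realization T τ).graph.Adj x y := by
    rintro τ (u | i) (v | j) h h' <;>
      simp [show (realization T τ).graph = completeBipartiteGraph (Fin 2) (Fin n) from rfl] at h h'
  have h1 : ∀ u i x y, (realization T σ).Crosses (Sum.inl u) (Sum.inr i) x y ↔
      (realization T π).Crosses (Sum.inl (e u)) (Sum.inr (f i)) (Equiv.sumCongr e f x)
        (Equiv.sumCongr e f y) := by
    rintro u i (v | j) (v' | j')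
    · exact iff_of_false (fun h => no _ _ _ (by simp) h.2.1) (fun h => no _ _ _ (by simp) h.2.1)
    · exact h _ _ _ _
    · rw [GeometricGraph.crosses_swap_right, GeometricGraph.crosses_swap_right _ (Sum.inl (e u))]
      exact h _ _ _ _
    · exact iff_of_false (fun h => no _ _ _ (by simp) h.2.1) (fun h => no _ _ _ (by simp) h.2.1)
  rintro (v | j) (v' | j') x y
  · exact iff_of_false (fun h => no _ _ _ (by simp) h.1) (fun h => no _ _ _ (by simp) h.1)
  · exact h1 _ _ _ _
  · rw [GeometricGraph.crosses_swap_left, GeometricGraph.crosses_swap_left (realization T π)]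
    exact h1 _ _ _ _
  · exact iff_of_false (fun h => no _ _ _ (by simp) h.1) (fun h => no _ _ _ (by simp) h.1)

/-- Having some crossing is invariant even under a geo-isomorphism that exchanges the two sides of
`K_{2,n}`. That exchange needs `n = 2`, where this invariant already determines the permutation. -/
theorem exists_inversion_iff_of_geoEquiv {σ π : Equiv.Perm (Fin n)} (h : GeoEquiv T σ π) :
    (∃ i j, IsInversion σ i j) ↔ ∃ i j, IsInversion π i j := by
  have key : ∀ τ : Equiv.Perm (Fin n), (∃ i j, IsInversion τ i j) ↔
      ∃ x y u v, (realization T τ).Crosses x y u v := by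
    intro τ
    constructor
    · rintro ⟨i, j, h⟩
      exact ⟨_, _, _, _, (crosses_inl_inr T τ 1 0 i j).2 (Or.inl ⟨rfl, rfl, h⟩)⟩
    · have hr : ∀ u i v j, (realization T τ).Crosses (Sum.inl u) (Sum.inr i) (Sum.inl v)
          (Sum.inr j) → ∃ i j, IsInversion τ i j := by
        intro u i v j h
        rcases (crosses_inl_inr T τ u v i j).1 h with h | h
        · exact ⟨_, _, h.2.2⟩
        · exact ⟨_, _, h.2.2⟩
      rintro ⟨x, y, u, v, h⟩
      have a1 : (completeBipartiteGraph (Fin 2) (Fin n)).Adj x y := h.1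
      have a2 : (completeBipartiteGraph (Fin 2) (Fin n)).Adj u v := h.2.1
      rcases x with x | x <;> rcases y with y | y <;> rcases u with u | u <;>
        rcases v with v | v <;> simp at a1 a2
      · exact hr _ _ _ _ h
      · exact hr _ _ _ _ ((GeometricGraph.crosses_swap_right _ _ _ _ _).1 h)
      · exact hr _ _ _ _ ((GeometricGraph.crosses_swap_left _ _ _ _ _).1 h)
      · exact hr _ _ _ _ ((GeometricGraph.crosses_swap_left _ _ _ _ _).1
          ((GeometricGraph.crosses_swap_right _ _ _ _ _).1 h))
  obtain ⟨g⟩ := h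
  rw [key, key]
  constructor
  · rintro ⟨x, y, u, v, h⟩
    exact ⟨_, _, _, _, (g.crosses_iff _ _ _ _).1 h⟩
  · rintro ⟨x, y, u, v, h⟩
    obtain ⟨x, rfl⟩ := g.toEquiv.surjective x
    obtain ⟨y, rfl⟩ := g.toEquiv.surjective y
    obtain ⟨u, rfl⟩ := g.toEquiv.surjective u
    obtain ⟨v, rfl⟩ := g.toEquiv.surjective v
    exact ⟨_, _, _, _, (g.crosses_iff _ _ _ _).2 h⟩

theorem perm_fin_two_eq_of_exists_inversion_iff : ∀ σ π : Equiv.Perm (Fin 2),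
    ((∃ i j, IsInversion σ i j) ↔ ∃ i j, IsInversion π i j) → σ = π := by
  unfold IsInversion
  decide

theorem geoEquiv_iff (σ π : Equiv.Perm (Fin n)) :
    GeoEquiv T σ π ↔ DigraphIsomorphic (permDigraph σ) (permDigraph π) ∨
      DigraphIsomorphic (permDigraph σ) (reverseDigraph (permDigraph π)) := by
  constructor
  · intro h
    have hinv := exists_inversion_iff_of_geoEquiv T h
    obtain ⟨g⟩ := h
    have hadj : ∀ x y, (x.isLeft ≠ y.isLeft) ↔
        ((g.toEquiv x).isLeft ≠ (g.toEquiv y).isLeft) := by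
      have hgr : ∀ (τ : Equiv.Perm (Fin n)) x y,
          (realization T τ).graph.Adj x y ↔ x.isLeft ≠ y.isLeft := by
        rintro τ (x | x) (y | y) <;>
          simp [show (realization T τ).graph = completeBipartiteGraph (Fin 2) (Fin n) from rfl]
      intro x y
      rw [← hgr σ, ← hgr π]
      exact g.adj_iff x y
    by_cases h0 : (g.toEquiv (Sum.inl 0)).isLeft
    · have hl : ∀ x, (g.toEquiv x).isLeft = x.isLeft := by
        intro x
        have := hadj (Sum.inl 0) x
        rw [h0] at this
        cases hx : x.isLeft <;> simp [hx] at this ⊢ <;> simpa using this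
      have e1 : ∀ u, ∃ v, g.toEquiv (Sum.inl u) = Sum.inl v := fun u =>
        Sum.isLeft_iff.1 (by rw [hl]; rfl)
      have e2 : ∀ i, ∃ j, g.toEquiv (Sum.inr i) = Sum.inr j := fun u =>
        Sum.isRight_iff.1 (by rw [← Sum.not_isLeft, hl]; simp)
      choose e he using e1
      choose f hf using e2
      have einj : Function.Injective e := fun u v h => by
        have := g.toEquiv.injective ((he u).trans ((congrArg Sum.inl h).trans (he v).symm))
        simpa using this
      have finj : Function.Injective f := fun u v h => by
        have := g.toEquiv.injective ((hf u).trans ((congrArg Sum.inr h).trans (hf v).symm))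
        simpa using this
      have hcr : ∀ i j, IsInversion σ i j ↔ (realization T π).Crosses (Sum.inl (e 1))
          (Sum.inr (f i)) (Sum.inl (e 0)) (Sum.inr (f j)) := by
        intro i j
        rw [← he, ← he, ← hf, ← hf]
        refine Iff.trans ?_ (g.crosses_iff _ _ _ _)
        rw [crosses_inl_inr]
        simp
      have fbij := Finite.injective_iff_bijective.1 finj
      -- Fixing `a` and `b` preserves the arcs; exchanging them reverses all arcs.
      have hc : (e 0 = 0 ∧ e 1 = 1) ∨ (e 0 = 1 ∧ e 1 = 0) := by
        have : e 0 ≠ e 1 := fun h => by simpa using einj h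
        omega
      rcases hc with ⟨c0, c1⟩ | ⟨c0, c1⟩
      · left
        refine ⟨⟨Equiv.ofBijective f fbij, ?_⟩⟩
        intro i j
        have := hcr i j
        rw [c0, c1, crosses_inl_inr] at this
        simp only [true_and, one_ne_zero, false_and, or_false] at this
        exact this.symm
      · right
        refine ⟨⟨Equiv.ofBijective f fbij, ?_⟩⟩
        intro i j
        have := hcr i j
        rw [c0, c1, crosses_inl_inr] at this
        simp only [true_and, zero_ne_one, false_and, false_or] at this
        exact this.symm
    -- Here the sides are exchanged, so `Fin 2` and `Fin n` inject into each other.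
    · left
      have hl : ∀ x, (g.toEquiv x).isLeft = !x.isLeft := by
        intro x
        have := hadj (Sum.inl 0) x
        simp only [Bool.not_eq_true] at h0
        rw [h0] at this
        cases hx : x.isLeft <;> simp [hx] at this ⊢ <;> simpa using this
      have e1 : ∀ u, ∃ v, g.toEquiv (Sum.inl u) = Sum.inr v := fun u =>
        Sum.isRight_iff.1 (by rw [← Sum.not_isLeft, hl]; simp)
      have e2 : ∀ i, ∃ j, g.toEquiv (Sum.inr i) = Sum.inl j := fun u =>
        Sum.isLeft_iff.1 (by rw [hl]; rfl)
      choose e he using e1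
      choose f hf using e2
      have einj : Function.Injective e := fun u v h => by
        have := g.toEquiv.injective ((he u).trans ((congrArg Sum.inr h).trans (he v).symm))
        simpa using this
      have finj : Function.Injective f := fun u v h => by
        have := g.toEquiv.injective ((hf u).trans ((congrArg Sum.inl h).trans (hf v).symm))
        simpa using this
      obtain rfl : n = 2 := le_antisymm (by simpa using Fintype.card_le_of_injective f finj)
        (by simpa using Fintype.card_le_of_injective e einj)
      rw [perm_fin_two_eq_of_exists_inversion_iff σ π hinv]
      exact ⟨RelIso.refl _⟩
  · rintro (h | h)
    · obtain ⟨f⟩ := h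
      apply geoEquiv_of_sum T σ π (Equiv.refl _) f.toEquiv
      intro u v i j
      have h1 : IsInversion π (f i) (f j) ↔ IsInversion σ i j := f.map_rel_iff
      have h2 : IsInversion π (f j) (f i) ↔ IsInversion σ j i := f.map_rel_iff
      rw [crosses_inl_inr, crosses_inl_inr, ← h1, ← h2]
      rfl
    · obtain ⟨f⟩ := h
      apply geoEquiv_of_sum T σ π (Equiv.swap 0 1) f.toEquiv
      intro u v i j
      have h1 : IsInversion π (f j) (f i) ↔ IsInversion σ i j := f.map_rel_iff
      have h2 : IsInversion π (f i) (f j) ↔ IsInversion σ j i := f.map_rel_iff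
      rw [crosses_inl_inr, crosses_inl_inr, ← h1, ← h2]
      have hs : ∀ w : Fin 2, (Equiv.swap 0 1 w = 0 ↔ w = 1) ∧ (Equiv.swap 0 1 w = 1 ↔ w = 0) := by
        decide
      simp only [(hs _).1, (hs _).2]
      exact or_comm

/-- Inverting exchanges positions and values, hence the two inequalities that define an inversion;
the map `σ⁻¹` carries values to positions and reverses each arc. -/
theorem digraphIsomorphic_inv (σ : Equiv.Perm (Fin n)) :
    DigraphIsomorphic (permDigraph σ) (reverseDigraph (permDigraph σ⁻¹)) := by
  refine ⟨⟨σ⁻¹, ?_⟩⟩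
  intro i j
  change (σ⁻¹ j < σ⁻¹ i ∧ σ⁻¹⁻¹ (σ⁻¹ i) < σ⁻¹⁻¹ (σ⁻¹ j)) ↔ (i < j ∧ σ⁻¹ j < σ⁻¹ i)
  simp [and_comm]

theorem DigraphIsomorphic.symm {V W : Type*} {D : Digraph V} {E : Digraph W} :
    DigraphIsomorphic D E → DigraphIsomorphic E D := fun ⟨e⟩ => ⟨e.symm⟩

theorem DigraphIsomorphic.trans {V W X : Type*} {D : Digraph V} {E : Digraph W} {F : Digraph X} :
    DigraphIsomorphic D E → DigraphIsomorphic E F → DigraphIsomorphic D F :=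
  fun ⟨e⟩ ⟨f⟩ => ⟨e.trans f⟩

theorem DigraphIsomorphic.reverse {V W : Type*} {D : Digraph V} {E : Digraph W} :
    DigraphIsomorphic D E → DigraphIsomorphic (reverseDigraph D) (reverseDigraph E) :=
  fun ⟨e⟩ => ⟨⟨e.toEquiv, fun {_ _} => e.map_rel_iff⟩⟩

theorem geoClass_eq_union (π : Equiv.Perm (Fin n)) :
    geoClass T π = {σ | Represents (permDigraph π) σ} ∪ {σ | Represents (permDigraph π) σ⁻¹} := by
  ext σ
  simp only [geoClass, Set.mem_ofPred_eq, geoEquiv_iff, Set.mem_union, Represents]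
  refine or_congr ⟨fun h => h.symm, fun h => h.symm⟩ ⟨fun h => ?_, fun h => ?_⟩
  · exact h.reverse.symm.trans (digraphIsomorphic_inv σ).reverse
  · exact (digraphIsomorphic_inv σ).trans h.symm.reverse

end Geo

/-! ### Realizers: pairs of linear orders representing a digraph -/

/-- Strict total orders. -/
structure StrictTotal {V : Type*} (r : V → V → Prop) : Prop where
  irrefl : ∀ u, ¬ r u u
  trans : ∀ u v w, r u v → r v w → r u w
  total : ∀ u v, u ≠ v → r u v ∨ r v u

theorem StrictTotal.not_iff {V : Type*} {r : V → V → Prop} (h : StrictTotal r) {u v : V}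
    (huv : u ≠ v) : ¬ r u v ↔ r v u :=
  ⟨fun h' => (h.total u v huv).resolve_left h', fun h1 h2 => h.irrefl _ (h.trans _ _ _ h1 h2)⟩

theorem strictTotal_of_equiv {V : Type*} {n : ℕ} (e : V ≃ Fin n) :
    StrictTotal fun u v => e u < e v where
  irrefl _ := lt_irrefl _
  trans _ _ _ := lt_trans
  total _ _ h := lt_or_gt_of_ne fun h' => h (e.injective h')

/-- A numbering is determined by the order it induces, as `Fin n` has no order automorphism but the
identity. -/
theorem equiv_fin_eq_of_lt_iff {V : Type*} {n : ℕ} {e e' : V ≃ Fin n}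
    (h : ∀ u v, e u < e v ↔ e' u < e' v) : e = e' := by
  let g : Fin n ≃o Fin n := ⟨e.symm.trans e', fun {a b} => by
    have := h (e.symm b) (e.symm a)
    simp only [Equiv.apply_symm_apply] at this
    simp only [Equiv.trans_apply]
    rw [← not_lt, ← this, not_lt]⟩
  have hg : g = OrderIso.refl _ := Subsingleton.elim _ _
  ext u
  have := congrArg (fun k : Fin n ≃o Fin n => k (e u)) hg
  have h2 : e' u = e u := by simpa [g] using this
  rw [h2]

theorem StrictTotal.exists_equiv {V : Type*} [Finite V] {n : ℕ} (hn : Nat.card V = n)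
    {r : V → V → Prop} (hr : StrictTotal r) : ∃ e : V ≃ Fin n, ∀ u v, r u v ↔ e u < e v := by
  classical
  have := Fintype.ofFinite V
  have : IsStrictTotalOrder V r :=
    { trichotomous := fun a b h1 h2 => by
        by_contra h
        exact (hr.total a b h).elim h1 h2
      irrefl := hr.irrefl
      trans := hr.trans }
  let _ := linearOrderOfSTO r
  have e := Fintype.orderIsoFinOfCardEq V (k := n) (by rw [← hn, Nat.card_eq_fintype_card])
  refine ⟨e.symm.toEquiv, fun u v => ?_⟩
  exact (e.symm.lt_iff_lt (x := u) (y := v)).symm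

/-- The pairs of strict total orders whose common pairs, after reversing the second order, are the
arcs of `D`. -/
def Realizer {V : Type*} (D : V → V → Prop) : Type _ :=
  {L : (V → V → Prop) × (V → V → Prop) //
    StrictTotal L.1 ∧ StrictTotal L.2 ∧ ∀ u v, D u v ↔ L.1 u v ∧ L.2 v u}

instance {V : Type*} [Finite V] (D : V → V → Prop) : Finite (Realizer D) := by
  unfold Realizer
  infer_instance

instance {V W : Type*} [Finite V] [Finite W] (D : V → V → Prop) (E : W → W → Prop) :
    Finite (D ≃r E) :=
  Finite.of_injective (fun e => (e : V → W)) DFunLike.coe_injective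

theorem card_relIso_eq {V W : Type*} {D : V → V → Prop} {E : W → W → Prop} (e : D ≃r E) :
    Nat.card (D ≃r E) = Nat.card (D ≃r D) :=
  Nat.card_congr
    { toFun := fun g => g.trans e.symm
      invFun := fun g => g.trans e
      left_inv := fun g => by ext; simp
      right_inv := fun g => by ext; simp }

/-- The realizer of `D` given by an isomorphism with a permutation digraph. -/
def realizerOfIso {V : Type*} {n : ℕ} {D : V → V → Prop} (σ : Equiv.Perm (Fin n))
    (e : D ≃r IsInversion σ) : Realizer D :=
  ⟨(fun u v => e u < e v, fun u v => σ⁻¹ (e u) < σ⁻¹ (e v)), strictTotal_of_equiv e.toEquiv,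
    strictTotal_of_equiv (e.toEquiv.trans σ⁻¹), fun _ _ => e.map_rel_iff.symm⟩

/-- The first order recovers the numbering `e` and the second recovers `σ⁻¹ ∘ e`, hence `σ`.
Conversely, if `e` and `g` number the two orders, then `σ = e ∘ g⁻¹` works. -/
theorem realizerOfIso_bijective {V : Type*} [Finite V] {n : ℕ} (hn : Nat.card V = n)
    (D : V → V → Prop) :
    Function.Bijective fun x : Σ σ : Equiv.Perm (Fin n), D ≃r IsInversion σ =>
      realizerOfIso x.1 x.2 := by
  constructor
  · rintro ⟨σ, e⟩ ⟨τ, g⟩ h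
    have h1 := congrArg (fun L => L.1.1) h
    have h2 := congrArg (fun L => L.1.2) h
    simp only [realizerOfIso] at h1 h2
    have heg : e.toEquiv = g.toEquiv :=
      equiv_fin_eq_of_lt_iff fun u v => iff_of_eq (congrFun (congrFun h1 u) v)
    have h3 : e.toEquiv.trans σ⁻¹ = g.toEquiv.trans τ⁻¹ :=
      equiv_fin_eq_of_lt_iff fun u v => iff_of_eq (congrFun (congrFun h2 u) v)
    have hστ : σ = τ := by
      apply inv_injective
      ext x
      have := congrArg (fun k => k (e.toEquiv.symm x)) h3
      simp only [Equiv.trans_apply, heg, Equiv.apply_symm_apply] at this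
      rw [this]
    subst hστ
    congr 1
    exact RelIso.toEquiv_injective heg
  · rintro ⟨⟨L, M⟩, hL, hM, hD⟩
    obtain ⟨e, he⟩ := hL.exists_equiv hn
    obtain ⟨g, hg⟩ := hM.exists_equiv hn
    have hinv : ∀ u, (g.symm.trans e : Equiv.Perm (Fin n))⁻¹ (e u) = g u := fun u => by
      rw [Equiv.Perm.inv_eq_iff_eq]
      simp
    refine ⟨⟨g.symm.trans e, ⟨e, fun {u v} => ?_⟩⟩, ?_⟩
    · simp only [IsInversion, hinv]
      rw [hD, he, hg]
    · apply Subtype.ext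
      simp only [realizerOfIso, RelIso.coe_fn_mk, hinv]
      ext u v
      · exact (he u v).symm
      · exact (hg u v).symm

/-- Sort the realizers by `σ`: the isomorphisms from `D` to `D(σ)`, if any exist, are as many as the
automorphisms of `D`. -/
theorem card_realizer {V : Type*} [Finite V] {n : ℕ} (hn : Nat.card V = n) (D : Digraph V) :
    Nat.card (Realizer D.Adj) =
      {σ : Equiv.Perm (Fin n) | Represents D σ}.ncard * Nat.card (D.Adj ≃r D.Adj) := by
  classical
  rw [← Nat.card_congr (Equiv.ofBijective _ (realizerOfIso_bijective hn D.Adj)), Nat.card_sigma]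
  have h : ∀ σ : Equiv.Perm (Fin n), Nat.card (D.Adj ≃r IsInversion σ) =
      if Represents D σ then Nat.card (D.Adj ≃r D.Adj) else 0 := by
    intro σ
    split_ifs with h
    · obtain ⟨e⟩ := h
      exact card_relIso_eq e
    · have : IsEmpty (D.Adj ≃r IsInversion σ) := ⟨fun e => h ⟨e⟩⟩
      simp
  rw [Finset.sum_congr rfl fun σ _ => h σ, ← Finset.sum_filter, Finset.sum_const, smul_eq_mul,
    Set.ncard_eq_toFinset_card']
  congr 2
  ext
  simp

/-- The number of realizers of `D` divided by the number of its automorphisms. -/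
noncomputable def realizerRatio {V : Type*} (D : V → V → Prop) : ℚ :=
  Nat.card (Realizer D) / Nat.card (D ≃r D)

theorem card_aut_ne_zero {V : Type*} [Finite V] (D : V → V → Prop) :
    (Nat.card (D ≃r D) : ℚ) ≠ 0 := by
  have : Nonempty (D ≃r D) := ⟨RelIso.refl _⟩
  exact_mod_cast Nat.card_pos.ne'

theorem realizerRatio_eq_ncard {V : Type*} [Finite V] {n : ℕ} (hn : Nat.card V = n)
    (D : Digraph V) :
    realizerRatio D.Adj = {σ : Equiv.Perm (Fin n) | Represents D σ}.ncard := by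
  rw [realizerRatio, card_realizer hn, Nat.cast_mul, mul_div_assoc, div_self (card_aut_ne_zero _),
    mul_one]

theorem realizerRatio_congr {V W : Type*} [Finite V] [Finite W] {D : V → V → Prop}
    {E : W → W → Prop} (e : D ≃r E) : realizerRatio D = realizerRatio E := by
  rw [realizerRatio_eq_ncard rfl ⟨D⟩, realizerRatio_eq_ncard (Nat.card_congr e.toEquiv).symm ⟨E⟩]
  congr 2
  ext σ
  have h : DigraphIsomorphic (V := V) (W := W) ⟨D⟩ ⟨E⟩ := ⟨e⟩
  exact ⟨fun h' => h.symm.trans h', fun h' => h.trans h'⟩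

/-! ### Modular partitions -/

section Partition

variable {V ι : Type*} (D : V → V → Prop) (f : V → ι)

/-- The relation induced by `D` on the fiber of `f` over `i`. -/
def fiberRel (i : ι) : {v // f v = i} → {v // f v = i} → Prop := fun u v => D u v

/-- The lexicographic sum of relations on the fibers of `f` along a relation on the base. -/
def lexRel (s : ι → ι → Prop) (L : ∀ i, {v // f v = i} → {v // f v = i} → Prop) (u v : V) : Prop :=
  s (f u) (f v) ∨ ∃ h : f u = f v, L (f v) ⟨u, h⟩ ⟨v, rfl⟩

variable {f}

theorem lexRel_of_ne {s : ι → ι → Prop} {L : ∀ i, {v // f v = i} → {v // f v = i} → Prop} {u v : V}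
    (h : f u ≠ f v) : lexRel f s L u v ↔ s (f u) (f v) := by
  simp [lexRel, h]

theorem lexRel_coe {s : ι → ι → Prop} (hs : StrictTotal s)
    {L : ∀ i, {v // f v = i} → {v // f v = i} → Prop} {i : ι} (u v : {v // f v = i}) :
    lexRel f s L u v ↔ L i u v := by
  obtain ⟨u, hu⟩ := u
  obtain ⟨v, rfl⟩ := v
  have := hs.irrefl (f v)
  simp [lexRel, hu, this]

theorem StrictTotal.lexRel {s : ι → ι → Prop} (hs : StrictTotal s)
    {L : ∀ i, {v // f v = i} → {v // f v = i} → Prop} (hL : ∀ i, StrictTotal (L i)) :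
    StrictTotal (lexRel f s L) where
  irrefl u h := (hL (f u)).irrefl ⟨u, rfl⟩ ((lexRel_coe hs (i := f u) ⟨u, rfl⟩ ⟨u, rfl⟩).1 h)
  trans u v w huv hvw := by
    by_cases h1 : f u = f v
    · by_cases h2 : f v = f w
      · have a := (lexRel_coe hs (i := f w) ⟨u, h1.trans h2⟩ ⟨v, h2⟩).1 huv
        have b := (lexRel_coe hs (i := f w) ⟨v, h2⟩ ⟨w, rfl⟩).1 hvw
        exact (lexRel_coe hs (i := f w) ⟨u, h1.trans h2⟩ ⟨w, rfl⟩).2 ((hL _).trans _ _ _ a b)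
      · rw [lexRel_of_ne h2] at hvw
        exact Or.inl (h1 ▸ hvw)
    · rw [lexRel_of_ne h1] at huv
      by_cases h2 : f v = f w
      · exact Or.inl (h2 ▸ huv)
      · rw [lexRel_of_ne h2] at hvw
        exact Or.inl (hs.trans _ _ _ huv hvw)
  total u v h := by
    by_cases h1 : f u = f v
    · refine ((hL (f v)).total ⟨u, h1⟩ ⟨v, rfl⟩ (by simpa using h)).imp ?_ ?_
      · exact (lexRel_coe hs (i := f v) ⟨u, h1⟩ ⟨v, rfl⟩).2
      · exact (lexRel_coe hs (i := f v) ⟨v, rfl⟩ ⟨u, h1⟩).2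
    · exact (hs.total _ _ h1).imp Or.inl Or.inl

/-- Every fiber of `f` is an interval of `L`. -/
def FiberInterval (f : V → ι) (L : V → V → Prop) : Prop :=
  ∀ u u' v v', f u = f u' → f v = f v' → f u ≠ f v → L u v → L u' v'

/-- When fibers are intervals, comparing elements of different fibers depends only on the fibers, so
`L` descends to the index set. -/
theorem exists_base_of_fiberInterval (hf : Function.Surjective f) {L : V → V → Prop}
    (hL : StrictTotal L) (hI : FiberInterval f L) :
    ∃ s : ι → ι → Prop, StrictTotal s ∧ ∀ u v, f u ≠ f v → (s (f u) (f v) ↔ L u v) := by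
  let s : ι → ι → Prop := fun i j => i ≠ j ∧ ∃ u v, f u = i ∧ f v = j ∧ L u v
  have key : ∀ u v, f u ≠ f v → (s (f u) (f v) ↔ L u v) := by
    intro u v h
    refine ⟨fun ⟨_, u', v', hu, hv, h'⟩ => ?_, fun h' => ⟨h, u, v, rfl, rfl, h'⟩⟩
    exact hI u' u v' v hu hv (by rwa [hu, hv]) h'
  refine ⟨s, ⟨fun i h => h.1 rfl, ?_, ?_⟩, key⟩
  · intro i j k hij hjk
    obtain ⟨u, rfl⟩ := hf i
    obtain ⟨v, rfl⟩ := hf j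
    obtain ⟨w, rfl⟩ := hf k
    have huv := (key _ _ hij.1).1 hij
    have hvw := (key _ _ hjk.1).1 hjk
    by_cases huw : f u = f w
    · have := hI v v w u rfl huw.symm hjk.1 hvw
      exact absurd (hL.trans _ _ _ huv this) (hL.irrefl _)
    · exact (key _ _ huw).2 (hL.trans _ _ _ huv hvw)
  · intro i j hij
    obtain ⟨u, rfl⟩ := hf i
    obtain ⟨v, rfl⟩ := hf j
    rw [key _ _ hij, key _ _ hij.symm]
    exact hL.total _ _ fun h => hij (h ▸ rfl)

theorem StrictTotal.fiberRel {L : V → V → Prop} (hL : StrictTotal L) (i : ι) :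
    StrictTotal (fiberRel L f i) where
  irrefl _ := hL.irrefl _
  trans _ _ _ := hL.trans _ _ _
  total _ _ h := hL.total _ _ fun h' => h (Subtype.ext h')

theorem lexRel_fiberRel {s : ι → ι → Prop} (hs : StrictTotal s) {L : V → V → Prop}
    (h : ∀ u v, f u ≠ f v → (s (f u) (f v) ↔ L u v)) : lexRel f s (fun i => fiberRel L f i) = L := by
  ext u v
  by_cases huv : f u = f v
  · exact lexRel_coe hs (i := f v) ⟨u, huv⟩ ⟨v, rfl⟩
  · rw [lexRel_of_ne huv, h _ _ huv]

variable {D} {E : ι → ι → Prop}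

/-- Each realizer is, in exactly one way, the lexicographic sum of realizers of the fibers along a
realizer of the quotient. -/
theorem card_realizer_eq_of_partition [Fintype ι] [Finite V] (hf : Function.Surjective f)
    (hE : ∀ i, ¬ E i i) (hDE : ∀ u v, f u ≠ f v → (D u v ↔ E (f u) (f v)))
    (hI : ∀ L : Realizer D, FiberInterval f L.1.1 ∧ FiberInterval f L.1.2) :
    Nat.card (Realizer D) = Nat.card (Realizer E) * ∏ i, Nat.card (Realizer (fiberRel D f i)) := by
  rw [← Nat.card_pi, ← Nat.card_prod]
  let F : Realizer E × (∀ i, Realizer (fiberRel D f i)) → Realizer D := fun x =>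
    ⟨(lexRel f x.1.1.1 fun i => (x.2 i).1.1, lexRel f x.1.1.2 fun i => (x.2 i).1.2),
      x.1.2.1.lexRel fun i => (x.2 i).2.1, x.1.2.2.1.lexRel fun i => (x.2 i).2.2.1, by
        intro u v
        by_cases h : f u = f v
        · refine Iff.trans ((x.2 (f v)).2.2.2 ⟨u, h⟩ ⟨v, rfl⟩) ?_
          exact and_congr (lexRel_coe (L := fun i => (x.2 i).1.1) x.1.2.1 ⟨u, h⟩ ⟨v, rfl⟩).symm
            (lexRel_coe (L := fun i => (x.2 i).1.2) x.1.2.2.1 ⟨v, rfl⟩ ⟨u, h⟩).symm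
        · exact ((hDE _ _ h).trans (x.1.2.2.2 _ _)).trans
            (and_congr (lexRel_of_ne (L := fun i => (x.2 i).1.1) h).symm
              (lexRel_of_ne (L := fun i => (x.2 i).1.2) (Ne.symm h)).symm)⟩
  refine (Nat.card_congr (Equiv.ofBijective F ⟨?_, ?_⟩)).symm
  · rintro ⟨s, L⟩ ⟨t, M⟩ h
    have h1 : ∀ u v, lexRel f s.1.1 (fun i => (L i).1.1) u v ↔
        lexRel f t.1.1 (fun i => (M i).1.1) u v := fun u v =>
      iff_of_eq (congrFun (congrFun (congrArg (fun K => K.1.1) h) u) v)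
    have h2 : ∀ u v, lexRel f s.1.2 (fun i => (L i).1.2) u v ↔
        lexRel f t.1.2 (fun i => (M i).1.2) u v := fun u v =>
      iff_of_eq (congrFun (congrFun (congrArg (fun K => K.1.2) h) u) v)
    have base : ∀ {s t : ι → ι → Prop} {L M : ∀ i, {v // f v = i} → {v // f v = i} → Prop},
        StrictTotal s → StrictTotal t → (∀ u v, lexRel f s L u v ↔ lexRel f t M u v) →
        s = t ∧ L = M := by
      intro s t L M hs ht h
      constructor
      · ext i j
        obtain ⟨u, rfl⟩ := hf i
        obtain ⟨v, rfl⟩ := hf j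
        by_cases hij : f u = f v
        · rw [hij]
          exact iff_of_false (hs.irrefl _) (ht.irrefl _)
        · rw [← lexRel_of_ne hij (s := s) (L := L), h, lexRel_of_ne hij]
      · ext i u v
        exact (lexRel_coe hs u v).symm.trans ((h u v).trans (lexRel_coe ht u v))
    obtain ⟨b1, c1⟩ := base s.2.1 t.2.1 h1
    obtain ⟨b2, c2⟩ := base s.2.2.1 t.2.2.1 h2
    refine Prod.ext (Subtype.ext (Prod.ext b1 b2)) (funext fun i => Subtype.ext (Prod.ext ?_ ?_))
    · exact congrFun c1 i
    · exact congrFun c2 i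
  · intro L
    obtain ⟨s, hs, hs'⟩ := exists_base_of_fiberInterval hf L.2.1 (hI L).1
    obtain ⟨t, ht, ht'⟩ := exists_base_of_fiberInterval hf L.2.2.1 (hI L).2
    refine ⟨⟨⟨(s, t), hs, ht, ?_⟩, fun i => ⟨(fiberRel L.1.1 f i, fiberRel L.1.2 f i),
      L.2.1.fiberRel i, L.2.2.1.fiberRel i, fun u v => L.2.2.2 u v⟩⟩, ?_⟩
    · intro i j
      obtain ⟨u, rfl⟩ := hf i
      obtain ⟨v, rfl⟩ := hf j
      by_cases hij : f u = f v
      · rw [hij]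
        exact iff_of_false (hE _) fun h => hs.irrefl _ h.1
      · exact (hDE _ _ hij).symm.trans ((L.2.2.2 u v).trans
          (and_congr (hs' _ _ hij).symm (ht' _ _ (Ne.symm hij)).symm))
    · exact Subtype.ext (Prod.ext (lexRel_fiberRel hs hs') (lexRel_fiberRel ht ht'))

/-- The automorphisms of the quotient that are induced by automorphisms. -/
def QuotientAut (D : V → V → Prop) (f : V → ι) (E : ι → ι → Prop) : Type _ :=
  {τ : E ≃r E // ∀ i, Nonempty (fiberRel D f i ≃r fiberRel D f (τ i))}

instance [Finite ι] : Finite (QuotientAut D f E) := by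
  unfold QuotientAut
  infer_instance

/-- An automorphism amounts to a liftable `τ` on the quotient and a choice of isomorphisms from
fiber `i` to fiber `τ i`. The number of choices does not depend on `τ`, by `card_relIso_eq`. -/
theorem card_aut_eq_of_partition [Fintype ι] [Finite V] (hf : Function.Surjective f)
    (hE : ∀ i, ¬ E i i) (hDE : ∀ u v, f u ≠ f v → (D u v ↔ E (f u) (f v)))
    (hA : ∀ (g : D ≃r D) u v, f u = f v ↔ f (g u) = f (g v)) :
    Nat.card (D ≃r D) =
      Nat.card (QuotientAut D f E) * ∏ i, Nat.card (fiberRel D f i ≃r fiberRel D f i) := by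
  have := Fintype.ofFinite (QuotientAut D f E)
  have hsum : Nat.card (Σ τ : QuotientAut D f E, ∀ i, fiberRel D f i ≃r fiberRel D f (τ.1 i)) =
      Nat.card (QuotientAut D f E) * ∏ i, Nat.card (fiberRel D f i ≃r fiberRel D f i) := by
    rw [Nat.card_sigma, Finset.sum_congr rfl fun τ _ => ?_, Finset.sum_const, Finset.card_univ,
      Nat.card_eq_fintype_card, smul_eq_mul]
    rw [Nat.card_pi]
    exact Finset.prod_congr rfl fun i _ => card_relIso_eq (τ.2 i).some
  rw [← hsum]
  let F (x : Σ τ : QuotientAut D f E, ∀ i, fiberRel D f i ≃r fiberRel D f (τ.1 i)) (u : V) : V :=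
    (x.2 (f u) ⟨u, rfl⟩).1
  have F_eq : ∀ x i (u : {v // f v = i}), F x u = (x.2 i u).1 := by
    rintro x i ⟨u, rfl⟩
    rfl
  have f_F : ∀ x u, f (F x u) = x.1.1 (f u) := fun x u => (x.2 (f u) ⟨u, rfl⟩).2
  have F_inj : ∀ x, Function.Injective (F x) := by
    intro x u v h
    have h1 : f u = f v := x.1.1.injective (by rw [← f_F, ← f_F, h])
    have h2 := F_eq x (f v) ⟨u, h1⟩
    have h3 := F_eq x (f v) ⟨v, rfl⟩
    have := (x.2 (f v)).injective (Subtype.ext (h2.symm.trans (h.trans h3)))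
    exact congrArg Subtype.val this
  let A (x : Σ τ : QuotientAut D f E, ∀ i, fiberRel D f i ≃r fiberRel D f (τ.1 i)) : D ≃r D :=
    ⟨Equiv.ofBijective (F x) (Finite.injective_iff_bijective.1 (F_inj x)), by
      intro u v
      change D (F x u) (F x v) ↔ D u v
      by_cases h : f u = f v
      · rw [F_eq x (f v) ⟨u, h⟩, F_eq x (f v) ⟨v, rfl⟩]
        exact (x.2 (f v)).map_rel_iff
      · rw [hDE _ _ h, hDE, f_F, f_F]
        · exact x.1.1.map_rel_iff
        · rw [f_F, f_F]
          exact fun h' => h (x.1.1.injective h')⟩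
  refine (Nat.card_congr (Equiv.ofBijective A ⟨?_, ?_⟩)).symm
  · rintro ⟨τ, g⟩ ⟨τ', g'⟩ h
    have hF : ∀ u, F ⟨τ, g⟩ u = F ⟨τ', g'⟩ u := fun u => congrArg (fun k : D ≃r D => k u) h
    have hτ : τ = τ' := by
      apply Subtype.ext
      ext i
      obtain ⟨u, rfl⟩ := hf i
      have := congrArg f (hF u)
      rwa [f_F, f_F] at this
    subst hτ
    congr 1
    funext i
    ext u
    have := hF u
    rw [F_eq, F_eq] at this
    exact this
  · intro g
    obtain ⟨c, hc⟩ := hf.hasRightInverse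
    -- The induced action on fibers, read off at chosen representatives `c i`.
    let t : ι → ι := fun i => f (g (c i))
    have ht : ∀ u, f (g u) = t (f u) := fun u => (hA g _ _).1 (hc _).symm
    have t_inj : Function.Injective t := fun i j h => by
      have := (hA g _ _).2 h
      rwa [hc, hc] at this
    let τ : E ≃r E := ⟨Equiv.ofBijective t (Finite.injective_iff_bijective.1 t_inj), by
      intro i j
      change E (t i) (t j) ↔ E i j
      by_cases hij : i = j
      · subst hij
        exact iff_of_false (hE _) (hE _)
      · obtain ⟨u, rfl⟩ := hf i
        obtain ⟨v, rfl⟩ := hf j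
        rw [← hDE _ _ hij, ← ht, ← ht, ← hDE _ _ fun h => hij ((hA g _ _).2 h)]
        exact g.map_rel_iff⟩
    let h : ∀ i, fiberRel D f i ≃r fiberRel D f (τ i) := fun i =>
      ⟨g.toEquiv.subtypeEquiv fun u => by
        change f u = i ↔ f (g u) = t i
        rw [ht]
        exact t_inj.eq_iff.symm, fun {u v} => g.map_rel_iff⟩
    refine ⟨⟨⟨τ, fun i => ⟨h i⟩⟩, h⟩, ?_⟩
    ext u
    rfl

theorem realizerRatio_eq_of_partition [Fintype ι] [Finite V] (hf : Function.Surjective f)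
    (hE : ∀ i, ¬ E i i) (hDE : ∀ u v, f u ≠ f v → (D u v ↔ E (f u) (f v)))
    (hI : ∀ L : Realizer D, FiberInterval f L.1.1 ∧ FiberInterval f L.1.2)
    (hA : ∀ (g : D ≃r D) u v, f u = f v ↔ f (g u) = f (g v)) :
    realizerRatio D = (Nat.card (Realizer E) / Nat.card (QuotientAut D f E) : ℚ) *
      ∏ i, realizerRatio (fiberRel D f i) := by
  simp only [realizerRatio]
  rw [card_realizer_eq_of_partition hf hE hDE hI, card_aut_eq_of_partition hf hE hDE hA,
    Finset.prod_div_distrib]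
  push_cast
  rw [mul_div_mul_comm]

end Partition

/-! ### Realizers and automorphisms of the quotients: no arcs, or a linear order -/

section Base

variable {ι : Type*}

/-- Without arcs the two orders can never disagree, so a realizer is a single linear order taken
twice. -/
theorem card_realizer_empty [Finite ι] :
    Nat.card (Realizer fun _ _ : ι => False) = (Nat.card ι)! := by
  let F : (ι ≃ Fin (Nat.card ι)) → Realizer fun _ _ : ι => False := fun e =>
    ⟨(fun u v => e u < e v, fun u v => e u < e v), strictTotal_of_equiv e, strictTotal_of_equiv e,
      fun _ _ => ⟨False.elim, fun h => lt_asymm h.1 h.2⟩⟩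
  rw [← Nat.card_congr (Equiv.ofBijective F ⟨?_, ?_⟩)]
  · classical
    have := Fintype.ofFinite ι
    rw [Nat.card_eq_fintype_card, Fintype.card_equiv (Finite.equivFin ι),
      Nat.card_eq_fintype_card]
  · intro e g h
    have h1 := congrArg (fun L => L.1.1) h
    exact equiv_fin_eq_of_lt_iff fun u v => iff_of_eq (congrFun (congrFun h1 u) v)
  · rintro ⟨⟨L, M⟩, hL, hM, h⟩
    obtain ⟨e, he⟩ := hL.exists_equiv rfl
    refine ⟨e, Subtype.ext (Prod.ext ?_ ?_)⟩
    · ext u v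
      exact (he u v).symm
    · ext u v
      change e u < e v ↔ M u v
      simp only at hL hM h
      rw [← he]
      by_cases huv : u = v
      · subst huv
        exact iff_of_false (hL.irrefl _) (hM.irrefl _)
      · have h1 := h u v
        have h2 := h v u
        have h3 := hL.not_iff huv
        have h4 := hM.not_iff huv
        tauto

/-- Every pair is an arc, which forces the first order to be `E` and the second to be its reverse.
-/
theorem StrictTotal.card_realizer {E : ι → ι → Prop} (hE : StrictTotal E) :
    Nat.card (Realizer E) = 1 := by
  rw [Nat.card_eq_one_iff_unique]
  refine ⟨⟨?_⟩, ⟨⟨(E, fun u v => E v u), hE, ⟨hE.irrefl, fun u v w a b => hE.trans _ _ _ b a,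
    fun u v h => hE.total _ _ h.symm⟩, fun u v => (and_self_iff).symm⟩⟩⟩
  have key : ∀ L : Realizer E, ∀ u v, (L.1.1 u v ↔ E u v) ∧ (L.1.2 u v ↔ E v u) := by
    rintro ⟨⟨L, M⟩, hL, hM, h⟩ u v
    simp only at hL hM h ⊢
    by_cases huv : u = v
    · subst huv
      exact ⟨iff_of_false (hL.irrefl _) (hE.irrefl _), iff_of_false (hM.irrefl _) (hE.irrefl _)⟩
    · have h1 := h u v
      have h2 := h v u
      have h3 := hL.not_iff huv
      have h4 := hM.not_iff huv
      have h5 := hE.not_iff huv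
      tauto
  intro L M
  refine Subtype.ext (Prod.ext ?_ ?_)
  · ext u v
    rw [(key L u v).1, (key M u v).1]
  · ext u v
    rw [(key L u v).2, (key M u v).2]

theorem StrictTotal.relIso_eq_refl [Finite ι] {E : ι → ι → Prop} (hE : StrictTotal E)
    (τ : E ≃r E) : τ = RelIso.refl E := by
  obtain ⟨e, he⟩ := hE.exists_equiv rfl
  have h : τ.toEquiv.trans e = e := equiv_fin_eq_of_lt_iff fun u v => by
    rw [← he, Equiv.trans_apply, Equiv.trans_apply, ← he]
    exact τ.map_rel_iff
  ext u
  have := congrArg (fun k => e.symm (k u)) h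
  simpa using this

end Base

/-! ### Partition into components of the graph or of its complement -/

section Cases

variable {V ι : Type*} {D : V → V → Prop} {f : V → ι} {H : SimpleGraph V}

/-- Walking along `H` moves the left argument within its fiber; antisymmetry across fibers then does
the same for the right one. `L` need not be a linear order: the lemma is also applied to `D` itself.
-/
theorem fiberInterval_of_step (hfr : ∀ u v, f u = f v ↔ H.Reachable u v) {L : V → V → Prop}
    (hL : ∀ u v, f u ≠ f v → (L u v ↔ ¬ L v u))
    (step : ∀ u u' v, H.Adj u u' → f u ≠ f v → L u v → L u' v) : FiberInterval f L := by
  have key : ∀ u u' v, f u = f u' → f u ≠ f v → L u v → L u' v := by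
    intro u u' v h
    obtain ⟨p⟩ := (hfr _ _).1 h
    clear h
    induction p with
    | nil => exact fun _ h => h
    | @cons a b c hab p ih =>
      intro h1 h2
      have : f a = f b := (hfr _ _).2 hab.reachable
      exact ih (this ▸ h1) (step _ _ _ hab h1 h2)
  intro u u' v v' hu hv huv h
  have h1 := key u u' v hu huv h
  have hn : f u' ≠ f v := hu ▸ huv
  have hn' : f u' ≠ f v' := hv ▸ hn
  rw [hL _ _ hn']
  intro h2
  rw [hL _ _ hn] at h1
  exact h1 (key v' v u' hv.symm hn'.symm h2)

theorem Realizer.asymm (L : Realizer D) {u v : V} (h : D u v) : ¬ D v u := by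
  intro h'
  rw [L.2.2.2] at h h'
  exact L.2.1.irrefl _ (L.2.1.trans _ _ _ h.1 h'.1)

theorem Realizer.trans (L : Realizer D) {u v w : V} (h : D u v) (h' : D v w) : D u w := by
  rw [L.2.2.2] at *
  exact ⟨L.2.1.trans _ _ _ h.1 h'.1, L.2.2.1.trans _ _ _ h'.2 h.2⟩

theorem StrictTotal.iff_not {r : V → V → Prop} (h : StrictTotal r) {u v : V}
    (huv : u ≠ v) : r u v ↔ ¬ r v u := (h.not_iff huv.symm).symm

/-- No arc joins different components, so `L` and `M` agree there. A vertex `v` outside the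
component of an edge `uu'` therefore lies between `u` and `u'` in both orders or in neither; but `L`
and `M` order `u` and `u'` oppositely, so it cannot separate them. -/
theorem fiberInterval_of_disconnected (hH : ∀ u v, H.Adj u v ↔ D u v ∨ D v u)
    (hfr : ∀ u v, f u = f v ↔ H.Reachable u v) (L : Realizer D) :
    FiberInterval f L.1.1 ∧ FiberInterval f L.1.2 := by
  have ne : ∀ {u v}, f u ≠ f v → u ≠ v := fun h h' => h (h' ▸ rfl)
  have hD : ∀ {u v}, f u ≠ f v → ¬ D u v := fun h h' =>
    h ((hfr _ _).2 ((hH _ _).2 (Or.inl h')).reachable)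
  obtain ⟨⟨L, M⟩, hL, hM, h⟩ := L
  simp only at hL hM h ⊢
  have hLM : ∀ {u v}, f u ≠ f v → (L u v ↔ M u v) := by
    intro u v huv
    have h1 := h u v
    have h2 := h v u
    have h3 := hL.not_iff (ne huv)
    have h4 := hM.not_iff (ne huv)
    have h5 := hD huv
    have h6 := hD huv.symm
    tauto
  have hI : FiberInterval f L := by
    refine fiberInterval_of_step hfr (fun u v huv => hL.iff_not (ne huv)) ?_
    intro u u' v huu' huv h'
    have hfu : f u = f u' := (hfr _ _).2 huu'.reachable
    have hu'v : f u' ≠ f v := hfu ▸ huv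
    rw [hL.iff_not (ne hu'v)]
    intro h''
    rcases (hH _ _).1 huu' with hd | hd
    · exact hM.irrefl u' (hM.trans _ _ _ ((h _ _).1 hd).2
        (hM.trans _ _ _ ((hLM huv).1 h') ((hLM hu'v.symm).1 h'')))
    · exact hL.irrefl u' (hL.trans _ _ _ ((h _ _).1 hd).1 (hL.trans _ _ _ h' h''))
  refine ⟨hI, ?_⟩
  intro u u' v v' hu hv huv h'
  rw [← hLM huv] at h'
  rw [← hLM (by rw [← hu, ← hv]; exact huv)]
  exact hI _ _ _ _ hu hv huv h'

theorem reachable_iff_of_relIso (hH : ∀ u v, H.Adj u v ↔ D u v ∨ D v u) (g : D ≃r D) (u v : V) :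
    (H.Reachable u v ↔ H.Reachable (g u) (g v)) ∧ (Hᶜ.Reachable u v ↔ Hᶜ.Reachable (g u) (g v)) := by
  have h : ∀ {u v}, H.Adj (g u) (g v) ↔ H.Adj u v := fun {u v} => by
    rw [hH, hH, g.map_rel_iff, g.map_rel_iff]
  let k : H ≃g H := ⟨g.toEquiv, h⟩
  let k' : Hᶜ ≃g Hᶜ := ⟨g.toEquiv, fun {u v} => by
    have := h (u := u) (v := v)
    simp only [SimpleGraph.compl_adj]
    exact and_congr g.injective.ne_iff (not_congr this)⟩
  exact ⟨k.reachable_iff.symm, k'.reachable_iff.symm⟩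

/-- With no arcs to preserve, the liftable permutations are those that keep each fiber in its
isomorphism class: a stabilizer, which is a product of symmetric groups. -/
theorem card_quotientAut_empty [Finite ι] (S : Setoid ι)
    (hS : ∀ i j, S i j ↔ Nonempty (fiberRel D f i ≃r fiberRel D f j)) :
    Nat.card (QuotientAut D f fun _ _ => False) =
      ∏ᶠ t : Quotient S, (Nat.card {i // Quotient.mk S i = t})! := by
  classical
  have := Fintype.ofFinite ι
  have e : QuotientAut D f (fun _ _ => False) ≃
      {g : Equiv.Perm ι // Quotient.mk S ∘ g = Quotient.mk S} :=
    { toFun := fun τ => ⟨τ.1.toEquiv, by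
        funext i
        exact (Quotient.sound ((hS _ _).2 (τ.2 i))).symm⟩
      invFun := fun g => ⟨⟨g.1, Iff.rfl⟩, fun i =>
        (hS _ _).1 (Quotient.exact (congrFun g.2 i).symm)⟩
      left_inv := fun _ => rfl
      right_inv := fun _ => rfl }
  rw [Nat.card_congr e, Nat.card_eq_fintype_card, DomMulAct.stabilizer_card,
    finprod_eq_prod_of_fintype]
  simp only [Nat.card_eq_fintype_card]

theorem realizerRatio_of_disconnected [Fintype ι] [Finite V] (hf : Function.Surjective f)
    (hH : ∀ u v, H.Adj u v ↔ D u v ∨ D v u) (hfr : ∀ u v, f u = f v ↔ H.Reachable u v)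
    (S : Setoid ι) (hS : ∀ i j, S i j ↔ Nonempty (fiberRel D f i ≃r fiberRel D f j)) :
    realizerRatio D = (((Nat.card ι)! : ℚ) /
      ∏ᶠ t : Quotient S, ((Nat.card {i // Quotient.mk S i = t})! : ℚ)) *
      ∏ i, realizerRatio (fiberRel D f i) := by
  rw [realizerRatio_eq_of_partition (E := fun _ _ => False) hf (fun _ h => h)
    (fun u v huv => iff_of_false (fun h => huv ((hfr _ _).2 ((hH _ _).2 (Or.inl h)).reachable)) id)
    (fiberInterval_of_disconnected hH hfr)
    (fun g u v => by rw [hfr, hfr]; exact (reachable_iff_of_relIso hH g u v).1),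
    card_realizer_empty, card_quotientAut_empty S hS]
  classical
  rw [finprod_eq_prod_of_fintype, finprod_eq_prod_of_fintype, Nat.cast_prod]

/-- Vertices in different components of the complement are always joined by an arc, so the quotient
`E` is a linear order and contributes the factor 1. -/
theorem realizerRatio_of_compl_disconnected [Fintype ι] [Finite V] (hf : Function.Surjective f)
    (hH : ∀ u v, H.Adj u v ↔ D u v ∨ D v u) (hfr : ∀ u v, f u = f v ↔ Hᶜ.Reachable u v)
    (L₀ : Realizer D) :
    realizerRatio D = ∏ i, realizerRatio (fiberRel D f i) := by
  have ne : ∀ {u v}, f u ≠ f v → u ≠ v := fun h h' => h (h' ▸ rfl)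
  have hD : ∀ {u v}, f u ≠ f v → (D u v ↔ ¬ D v u) := by
    intro u v h
    refine ⟨L₀.asymm, fun h' => ?_⟩
    by_contra h''
    refine h ((hfr _ _).2 (SimpleGraph.Adj.reachable ?_))
    rw [SimpleGraph.compl_adj, hH]
    exact ⟨ne h, by tauto⟩
  -- Arcs `u → v → u'` would compose to an arc between the non-adjacent `u` and `u'`.
  have hI : FiberInterval f D := by
    refine fiberInterval_of_step hfr (fun u v huv => hD huv) ?_
    intro u u' v huu' huv h
    have hfu : f u = f u' := (hfr _ _).2 huu'.reachable
    have hu'v : f u' ≠ f v := hfu ▸ huv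
    rw [hD hu'v]
    intro h'
    rw [SimpleGraph.compl_adj, hH] at huu'
    exact huu'.2 (Or.inl (L₀.trans h h'))
  let E : ι → ι → Prop := fun i j => i ≠ j ∧ ∃ u v, f u = i ∧ f v = j ∧ D u v
  have hDE : ∀ u v, f u ≠ f v → (D u v ↔ E (f u) (f v)) := by
    intro u v h
    refine ⟨fun h' => ⟨h, u, v, rfl, rfl, h'⟩, fun ⟨_, u', v', hu, hv, h'⟩ => ?_⟩
    exact hI u' u v' v hu hv (by rwa [hu, hv]) h'
  have hE : StrictTotal E := by
    refine ⟨fun i h => h.1 rfl, ?_, ?_⟩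
    · intro i j k hij hjk
      obtain ⟨u, rfl⟩ := hf i
      obtain ⟨v, rfl⟩ := hf j
      obtain ⟨w, rfl⟩ := hf k
      have huv := (hDE _ _ hij.1).2 hij
      have hvw := (hDE _ _ hjk.1).2 hjk
      by_cases huw : f u = f w
      · exact absurd (hI v v w u rfl huw.symm hjk.1 hvw) (L₀.asymm huv)
      · exact (hDE _ _ huw).1 (L₀.trans huv hvw)
    · intro i j hij
      obtain ⟨u, rfl⟩ := hf i
      obtain ⟨v, rfl⟩ := hf j
      rw [← hDE _ _ hij, ← hDE _ _ hij.symm, hD hij]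
      exact (em _).symm
  have hLI : ∀ L : Realizer D, FiberInterval f L.1.1 ∧ FiberInterval f L.1.2 := by
    rintro ⟨⟨L, M⟩, hL, hM, h⟩
    simp only at hL hM h ⊢
    -- Across fibers every pair is an arc, so both orders are dictated by `D` and inherit its
    -- intervals.
    have hLD : ∀ {u v}, f u ≠ f v → (L u v ↔ D u v) ∧ (M u v ↔ D v u) := by
      intro u v huv
      have h1 := h u v
      have h2 := h v u
      have h3 := hL.not_iff (ne huv)
      have h4 := hM.not_iff (ne huv)
      have h5 := hD huv
      tauto
    constructor
    · intro u u' v v' hu hv huv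
      rw [(hLD huv).1, (hLD (by rw [← hu, ← hv]; exact huv)).1]
      exact hI u u' v v' hu hv huv
    · intro u u' v v' hu hv huv
      rw [(hLD huv).2, (hLD (by rw [← hu, ← hv]; exact huv)).2]
      exact hI v v' u u' hv hu huv.symm
  have hQ : Nat.card (QuotientAut D f E) = 1 := by
    rw [Nat.card_eq_one_iff_unique]
    refine ⟨⟨fun τ τ' => Subtype.ext ?_⟩, ⟨⟨RelIso.refl E, fun i => ⟨RelIso.refl _⟩⟩⟩⟩
    rw [hE.relIso_eq_refl τ.1, hE.relIso_eq_refl τ'.1]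
  rw [realizerRatio_eq_of_partition hf hE.irrefl hDE hLI
    (fun g u v => by rw [hfr, hfr]; exact (reachable_iff_of_relIso hH g u v).2),
    hE.card_realizer, hQ, Nat.cast_one, div_one, one_mul]

end Cases

/-! ### Strong modules and connected components -/

section StrongModules

variable {V : Type*} {G : SimpleGraph V} {M N X : Set V}

/-- Complementation swaps "all" and "none". This lets a 1-node be treated through the components of
`Gᶜ`. -/
theorem isModule_compl : IsModule Gᶜ M ↔ IsModule G M := by
  refine forall₂_congr fun v hv => ?_
  have h : ∀ u ∈ M, (Gᶜ.Adj u v ↔ ¬ G.Adj u v) := fun u hu => by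
    rw [SimpleGraph.compl_adj]
    exact and_iff_right fun h => hv (h ▸ hu)
  constructor
  · rintro (h' | h')
    · exact Or.inr fun u hu => (h u hu).1 (h' u hu)
    · exact Or.inl fun u hu => not_not.1 fun h'' => h' u hu ((h u hu).2 h'')
  · rintro (h' | h')
    · exact Or.inr fun u hu h'' => (h u hu).1 h'' (h' u hu)
    · exact Or.inl fun u hu => (h u hu).2 (h' u hu)

theorem isStrongModule_compl : IsStrongModule Gᶜ M ↔ IsStrongModule G M := by
  simp only [IsStrongModule, isModule_compl]

theorem isStrongModule_univ : IsStrongModule G Set.univ :=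
  ⟨fun _ h => absurd trivial h, fun _ _ h => by simpa using h.2.2⟩

variable (G M) in
/-- The vertex set of the component of `v` in `G|M`. -/
def compOf (v : M) : Set V := Subtype.val '' ((G.induce M).connectedComponentMk v).supp

theorem mem_compOf {v : M} {x : V} :
    x ∈ compOf G M v ↔ ∃ h : x ∈ M, (G.induce M).Reachable ⟨x, h⟩ v := by
  simp [compOf]

theorem self_mem_compOf (v : M) : v.1 ∈ compOf G M v :=
  mem_compOf.2 ⟨v.2, SimpleGraph.Reachable.rfl⟩

theorem compOf_eq_iff {u v : M} : compOf G M u = compOf G M v ↔ (G.induce M).Reachable u v := by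
  rw [compOf, compOf, (Set.image_injective.2 Subtype.val_injective).eq_iff,
    SimpleGraph.ConnectedComponent.supp_inj, SimpleGraph.ConnectedComponent.eq]

theorem mem_componentsIn : X ∈ componentsIn G M ↔ ∃ v, compOf G M v = X := by
  constructor
  · rintro ⟨c, rfl⟩
    induction c using SimpleGraph.ConnectedComponent.ind with
    | _ v => exact ⟨v, rfl⟩
  · rintro ⟨v, rfl⟩
    exact ⟨_, rfl⟩

theorem compOf_eq_iff_mem (hX : X ∈ componentsIn G M) {u : M} : compOf G M u = X ↔ u.1 ∈ X := by
  obtain ⟨v, rfl⟩ := mem_componentsIn.1 hX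
  rw [compOf_eq_iff, mem_compOf]
  exact ⟨fun h => ⟨u.2, h⟩, fun ⟨_, h⟩ => h⟩

theorem componentsIn_subset (hX : X ∈ componentsIn G M) : X ⊆ M := by
  obtain ⟨v, rfl⟩ := mem_componentsIn.1 hX
  intro x hx
  exact (mem_compOf.1 hx).1

theorem componentsIn_nonempty (hX : X ∈ componentsIn G M) : X.Nonempty := by
  obtain ⟨v, rfl⟩ := mem_componentsIn.1 hX
  exact ⟨v, self_mem_compOf v⟩

theorem componentsIn_eq_of_mem (hX : X ∈ componentsIn G M) {Y : Set V}
    (hY : Y ∈ componentsIn G M) {x : V} (hx : x ∈ X) (hy : x ∈ Y) : X = Y := by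
  have hxM := componentsIn_subset hX hx
  exact ((compOf_eq_iff_mem hX (u := ⟨x, hxM⟩)).2 hx).symm.trans ((compOf_eq_iff_mem hY).2 hy)

theorem componentsIn_closed (hX : X ∈ componentsIn G M) {x y : V} (hx : x ∈ X) (hy : y ∈ M)
    (h : G.Adj x y) : y ∈ X := by
  obtain ⟨v, rfl⟩ := mem_componentsIn.1 hX
  obtain ⟨hxM, hr⟩ := mem_compOf.1 hx
  refine mem_compOf.2 ⟨hy, SimpleGraph.Reachable.trans (SimpleGraph.Adj.reachable ?_) hr⟩
  exact h.symm

theorem exists_adj_of_mem_componentsIn (hX : X ∈ componentsIn G M) {A : Set V} {u v : V}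
    (hu : u ∈ X) (huA : u ∈ A) (hv : v ∈ X) (hvA : v ∉ A) :
    ∃ x ∈ X, x ∈ A ∧ ∃ y ∈ X, y ∉ A ∧ G.Adj x y := by
  have huM := componentsIn_subset hX hu
  have hvM := componentsIn_subset hX hv
  have hr : (G.induce M).Reachable ⟨u, huM⟩ ⟨v, hvM⟩ :=
    compOf_eq_iff.1 (((compOf_eq_iff_mem hX).2 hu).trans ((compOf_eq_iff_mem hX).2 hv).symm)
  obtain ⟨p⟩ := hr
  obtain ⟨d, -, h1, h2⟩ := p.exists_boundary_dart {w | w.1 ∈ X ∧ w.1 ∈ A} ⟨hu, huA⟩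
    fun h => hvA h.2
  have hadj : G.Adj d.fst.1 d.snd.1 := d.adj
  have h3 := componentsIn_closed hX h1.1 d.snd.2 hadj
  exact ⟨_, h1.1, h1.2, _, h3, fun h => h2 ⟨h3, h⟩, hadj⟩

theorem IsModule.of_closed (hM : IsModule G M) (hX : X ⊆ M)
    (h : ∀ x ∈ X, ∀ y ∈ M, G.Adj x y → y ∈ X) : IsModule G X := by
  intro v hv
  by_cases hvM : v ∈ M
  · exact Or.inr fun u hu h' => hv (h u hu v hvM h')
  · exact (hM v hvM).imp (fun h u hu => h u (hX hu)) fun h u hu => h u (hX hu)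

/-- Suppose a module `N` overlaps the component `X`. If `N ⊆ M`, some edge `xy` of `X` leaves `N` at
`y`; then `y` is adjacent to all of `N`, including a vertex outside `X`, which is impossible. If `N`
is not inside `M`, it overlaps `M`. -/
theorem isStrongModule_of_mem_componentsIn (hM : IsStrongModule G M)
    (hX : X ∈ componentsIn G M) : IsStrongModule G X := by
  refine ⟨hM.1.of_closed (componentsIn_subset hX) fun x hx y hy => componentsIn_closed hX hx hy, ?_⟩
  rintro N hN ⟨⟨a, haX, haN⟩, ⟨b, hbX, hbN⟩, ⟨c, hcN, hcX⟩⟩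
  have hXM := componentsIn_subset hX
  by_cases hNM : N ⊆ M
  · obtain ⟨x, hx, hxN, y, hy, hyN, hxy⟩ := exists_adj_of_mem_componentsIn hX haX haN hbX hbN
    rcases hN y hyN with h | h
    · exact hcX (componentsIn_closed hX hy (hNM hcN) (h c hcN).symm)
    · exact h x hxN hxy
  · obtain ⟨d, hdN, hdM⟩ := Set.not_subset.1 hNM
    exact hM.2 N hN ⟨⟨a, hXM haX, haN⟩, ⟨b, hXM hbX, hbN⟩, ⟨d, hdN, hdM⟩⟩

/-- If `N` meets two components, take the component `Z` of a vertex of `M` outside `N`. Either `Z`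
meets `N` in the chosen vertex `c` and overlaps it, or `N` overlaps the union of `Z` with a
component meeting `N`; such a union is a module. -/
theorem exists_componentsIn_superset (hM : IsStrongModule G M) (hN : IsStrongModule G N)
    (hNM : N ⊂ M) (hne : N.Nonempty) : ∃ X ∈ componentsIn G M, N ⊆ X := by
  obtain ⟨a, ha⟩ := hne
  obtain ⟨b, hbM, hbN⟩ := Set.exists_of_ssubset hNM
  have haM := hNM.1 ha
  have hX : compOf G M ⟨a, haM⟩ ∈ componentsIn G M := mem_componentsIn.2 ⟨_, rfl⟩
  have hZ : compOf G M ⟨b, hbM⟩ ∈ componentsIn G M := mem_componentsIn.2 ⟨_, rfl⟩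
  have haX : a ∈ compOf G M ⟨a, haM⟩ := self_mem_compOf (⟨a, haM⟩ : M)
  have hbZ : b ∈ compOf G M ⟨b, hbM⟩ := self_mem_compOf (⟨b, hbM⟩ : M)
  refine ⟨_, hX, ?_⟩
  by_contra hNX
  obtain ⟨c, hcN, hcX⟩ := Set.not_subset.1 hNX
  -- a component that meets `N` lies inside `N`, or contains `N`
  have hXN : compOf G M ⟨a, haM⟩ ⊆ N := by
    by_contra h
    obtain ⟨d, hdX, hdN⟩ := Set.not_subset.1 h
    exact (isStrongModule_of_mem_componentsIn hM hX).2 N hN.1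
      ⟨⟨a, haX, ha⟩, ⟨d, hdX, hdN⟩, ⟨c, hcN, hcX⟩⟩
  by_cases hcZ : c ∈ compOf G M ⟨b, hbM⟩
  · refine (isStrongModule_of_mem_componentsIn hM hZ).2 N hN.1
      ⟨⟨c, hcZ, hcN⟩, ⟨b, hbZ, hbN⟩, ⟨a, ha, fun haZ => ?_⟩⟩
    rw [componentsIn_eq_of_mem hX hZ haX haZ] at hcX
    exact hcX hcZ
  · refine hN.2 (compOf G M ⟨a, haM⟩ ∪ compOf G M ⟨b, hbM⟩) ?_
      ⟨⟨a, ha, Or.inl haX⟩, ⟨c, hcN, fun h => h.elim hcX hcZ⟩, ⟨b, Or.inr hbZ, hbN⟩⟩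
    refine hM.1.of_closed (Set.union_subset (componentsIn_subset hX) (componentsIn_subset hZ)) ?_
    rintro x (hx | hx) y hy hxy
    · exact Or.inl (componentsIn_closed hX hx hy hxy)
    · exact Or.inr (componentsIn_closed hZ hx hy hxy)

theorem componentsIn_ssubset (hne : M.Nonempty) (hM : ¬ (G.induce M).Connected)
    (hX : X ∈ componentsIn G M) : X ⊂ M := by
  refine (componentsIn_subset hX).ssubset_of_ne ?_
  rintro rfl
  apply hM
  have : Nonempty X := hne.to_subtype
  refine ⟨fun u v => compOf_eq_iff.1 ?_⟩
  rw [(compOf_eq_iff_mem hX).2 u.2, (compOf_eq_iff_mem hX).2 v.2]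

theorem induce_compl_eq : Gᶜ.induce M = (G.induce M)ᶜ := by
  ext u v
  simp [Subtype.ext_iff]

end StrongModules

/-! ### The number of permutations represented by a digraph -/

section Count

variable {V : Type*} {G G' : SimpleGraph V} {D : Digraph V} {M : Set V}

/-- A realizer of `D` restricts to induced subgraphs. -/
def Realizer.restrict (L : Realizer D.Adj) (M : Set V) : Realizer (inducedDigraph D M).Adj :=
  ⟨(fun u v => L.1.1 u v, fun u v => L.1.2 u v),
    ⟨fun _ => L.2.1.irrefl _, fun _ _ _ => L.2.1.trans _ _ _,
      fun _ _ h => L.2.1.total _ _ fun h' => h (Subtype.ext h')⟩,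
    ⟨fun _ => L.2.2.1.irrefl _, fun _ _ _ => L.2.2.1.trans _ _ _,
      fun _ _ h => L.2.2.1.total _ _ fun h' => h (Subtype.ext h')⟩,
    fun _ _ => L.2.2.2 _ _⟩

/-- The map of a vertex to its component. -/
def compMap {P : Set V → Prop} (hP : ∀ X, P X ↔ X ∈ componentsIn G M) (v : M) : {X // P X} :=
  ⟨compOf G M v, (hP _).2 ⟨_, rfl⟩⟩

theorem compMap_surjective {P : Set V → Prop} (hP : ∀ X, P X ↔ X ∈ componentsIn G M) :
    Function.Surjective (compMap hP) := by
  rintro ⟨X, hX⟩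
  obtain ⟨v, hv⟩ := mem_componentsIn.1 ((hP X).1 hX)
  exact ⟨v, Subtype.ext hv⟩

theorem compMap_eq_iff {P : Set V → Prop} (hP : ∀ X, P X ↔ X ∈ componentsIn G M) (u v : M) :
    compMap hP u = compMap hP v ↔ (G.induce M).Reachable u v := by
  rw [← compOf_eq_iff, compMap, compMap, Subtype.mk.injEq]

theorem nonempty_fiberRel_compMap_relIso (D : Digraph V) {P : Set V → Prop}
    (hP : ∀ X, P X ↔ X ∈ componentsIn G M) (X : {X // P X}) :
    Nonempty (fiberRel (inducedDigraph D M).Adj (compMap hP) X ≃r (inducedDigraph D X.1).Adj) := by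
  have hX := (hP _).1 X.2
  have h : ∀ v : M, compMap hP v = X ↔ v.1 ∈ X.1 := fun v => by
    rw [← compOf_eq_iff_mem hX, compMap, Subtype.ext_iff]
  exact ⟨⟨⟨fun v => ⟨v.1.1, (h _).1 v.2⟩,
    fun x => ⟨⟨x.1, componentsIn_subset hX x.2⟩, (h _).2 x.2⟩, fun _ => rfl, fun _ => rfl⟩,
    Iff.rfl⟩⟩

variable [Finite V]

/-- Each 0-node properly inside `M` lies in exactly one component. The 0-nodes are those of `G`,
while the components are taken in `G'`, which is `G` at a 0-node and `Gᶜ` at a 1-node. -/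
theorem finprod_zeroNode_ssubset (hM : IsStrongModule G' M) (hne : M.Nonempty)
    (hd : ¬ (G'.induce M).Connected) (hG : ∀ N, IsStrongModule G N → IsStrongModule G' N)
    {P : Set V → Prop} (hP : ∀ X, P X ↔ X ∈ componentsIn G' M) (F : Set V → ℚ) :
    ∏ᶠ X : {X // P X}, ∏ᶠ N ∈ {N | IsZeroNode G N ∧ N ⊆ X.1}, F N =
      ∏ᶠ N ∈ {N | IsZeroNode G N ∧ N ⊂ M}, F N := by
  have hset : {N | IsZeroNode G N ∧ N ⊂ M} =
      ⋃ X : {X // P X}, {N | IsZeroNode G N ∧ N ⊆ X.1} := by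
    ext N
    rw [Set.mem_iUnion]
    symm
    constructor
    · rintro ⟨X, hN, hX⟩
      exact ⟨hN, hX.trans_ssubset (componentsIn_ssubset hne hd ((hP _).1 X.2))⟩
    · rintro ⟨hN, hNM⟩
      obtain ⟨X, hX, hNX⟩ := exists_componentsIn_superset hM (hG _ hN.1.1) hNM hN.1.2.nonempty
      exact ⟨⟨X, (hP _).2 hX⟩, hN, hNX⟩
  rw [hset, finprod_mem_iUnion]
  · intro X Y hXY
    refine Set.disjoint_left.2 fun N hX hY => hXY ?_
    obtain ⟨x, hx⟩ := hX.1.1.2.nonempty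
    exact Subtype.ext (componentsIn_eq_of_mem ((hP _).1 X.2) ((hP _).1 Y.2) (hX.2 hx) (hY.2 hx))
  · exact fun _ => Set.toFinite _

theorem realizerRatio_of_subsingleton (L : Realizer D.Adj) (h : ∀ u v : V, u = v) :
    realizerRatio D.Adj = 1 := by
  have hE : StrictTotal D.Adj :=
    ⟨fun u hu => L.asymm hu hu, fun _ _ _ => L.trans, fun u v huv => absurd (h u v) huv⟩
  have : Nat.card (D.Adj ≃r D.Adj) = 1 := by
    rw [Nat.card_eq_one_iff_unique]
    exact ⟨⟨fun τ τ' => by rw [hE.relIso_eq_refl τ, hE.relIso_eq_refl τ']⟩, ⟨RelIso.refl _⟩⟩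
  rw [realizerRatio, hE.card_realizer, this]
  simp

/-- Induction on the size of `M`: a 0-node contributes its own factor, a 1-node contributes 1, a
singleton gives the empty product, and prime nodes do not occur in a cograph. -/
theorem realizerRatio_induced_eq_finprod (hco : IsCograph G)
    (hG : ∀ u v, G.Adj u v ↔ D.Adj u v ∨ D.Adj v u) (L : Realizer D.Adj) (M : Set V)
    (hM : IsStrongModule G M) (hne : M.Nonempty) :
    realizerRatio (inducedDigraph D M).Adj =
      ∏ᶠ N ∈ {N | IsZeroNode G N ∧ N ⊆ M}, nodeFactor G D N := by
  classical
  induction hk : M.ncard using Nat.strong_induction_on generalizing M with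
  | _ k ih =>
    subst hk
    by_cases hnt : M.Nontrivial
    · have hGM : ∀ u v : M, (G.induce M).Adj u v ↔
          (inducedDigraph D M).Adj u v ∨ (inducedDigraph D M).Adj v u := fun u v => hG u v
      by_cases h1 : (G.induce M).Connected
      · by_cases h2 : (Gᶜ.induce M).Connected
        · exact absurd ⟨⟨hM, hnt⟩, h1, h2⟩ (hco M)
        · have hset : {N | IsZeroNode G N ∧ N ⊆ M} = {N | IsZeroNode G N ∧ N ⊂ M} := by
            ext N
            refine and_congr_right fun hN => ⟨fun h => h.ssubset_of_ne ?_, fun h => h.1⟩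
            rintro rfl
            exact hN.2 h1
          have hM' := isStrongModule_compl.2 hM
          have hP : ∀ X, X ∈ componentsIn Gᶜ M ↔ X ∈ componentsIn Gᶜ M := fun X => Iff.rfl
          have := Fintype.ofFinite {X // X ∈ componentsIn Gᶜ M}
          rw [hset, ← finprod_zeroNode_ssubset hM' hne h2 (fun N => isStrongModule_compl.2) hP,
            realizerRatio_of_compl_disconnected (compMap_surjective hP) hGM
              (fun u v => by rw [← induce_compl_eq]; exact compMap_eq_iff hP u v) (L.restrict M),
            finprod_eq_prod_of_fintype]
          refine Finset.prod_congr rfl fun X _ => ?_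
          rw [realizerRatio_congr (nonempty_fiberRel_compMap_relIso D hP X).some]
          exact ih _ (Set.ncard_lt_ncard (componentsIn_ssubset hne h2 X.2)) X.1
            (isStrongModule_compl.1 (isStrongModule_of_mem_componentsIn hM' X.2))
            (componentsIn_nonempty X.2) rfl
      · have hz : IsZeroNode G M := ⟨⟨hM, hnt⟩, h1⟩
        have hset : {N | IsZeroNode G N ∧ N ⊆ M} = insert M {N | IsZeroNode G N ∧ N ⊂ M} := by
          ext N
          rw [Set.mem_insert_iff]
          constructor
          · intro h
            by_cases hNM : N = M
            · exact Or.inl hNM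
            · exact Or.inr ⟨h.1, h.2.ssubset_of_ne hNM⟩
          · rintro (rfl | h)
            · exact ⟨hz, subset_rfl⟩
            · exact ⟨h.1, h.2.1⟩
        have hP : ∀ X, IsChild G M X ↔ X ∈ componentsIn G M := by
          refine fun X => ⟨?_, fun h => Or.inl ⟨hz, h⟩⟩
          rintro (h | h | h)
          · exact h.2
          · exact absurd h.1.2.1 h1
          · exact absurd h.1.2.1 h1
        have := Fintype.ofFinite {X // IsChild G M X}
        rw [hset, finprod_mem_insert _ (fun h => h.2.ne rfl) (Set.toFinite _),
          ← finprod_zeroNode_ssubset hM hne h1 (fun N => id) hP,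
          realizerRatio_of_disconnected (compMap_surjective hP) hGM (compMap_eq_iff hP)
            (childSetoid G D M) ?_, finprod_eq_prod_of_fintype (α := {X // IsChild G M X})]
        · refine congrArg₂ _ rfl (Finset.prod_congr rfl fun X _ => ?_)
          rw [realizerRatio_congr (nonempty_fiberRel_compMap_relIso D hP X).some]
          exact ih _ (Set.ncard_lt_ncard (componentsIn_ssubset hne h1 ((hP _).1 X.2))) X.1
            (isStrongModule_of_mem_componentsIn hM ((hP _).1 X.2))
            (componentsIn_nonempty ((hP _).1 X.2)) rfl
        · intro X Y
          obtain ⟨a⟩ := nonempty_fiberRel_compMap_relIso D hP X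
          obtain ⟨b⟩ := nonempty_fiberRel_compMap_relIso D hP Y
          exact ⟨fun ⟨e⟩ => ⟨(a.trans e).trans b.symm⟩, fun ⟨e⟩ => ⟨(a.symm.trans e).trans b⟩⟩
    · have hs : M.Subsingleton := Set.not_nontrivial_iff.1 hnt
      have hset : {N | IsZeroNode G N ∧ N ⊆ M} = ∅ := by
        ext N
        exact iff_of_false (fun h => hnt (h.1.1.2.mono h.2)) id
      rw [hset, finprod_mem_empty, realizerRatio_of_subsingleton (L.restrict M)]
      exact fun u v => Subtype.ext (hs u.2 v.2)

theorem realizerRatio_eq_finprod (hco : IsCograph G)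
    (hG : ∀ u v, G.Adj u v ↔ D.Adj u v ∨ D.Adj v u) (L : Realizer D.Adj) :
    realizerRatio D.Adj = ∏ᶠ N ∈ {N | IsZeroNode G N}, nodeFactor G D N := by
  -- The induction needs a non-empty module; on the empty vertex set both sides are 1.
  rcases isEmpty_or_nonempty V with h | h
  · have hset : {N | IsZeroNode G N} = ∅ := by
      ext N
      exact iff_of_false (fun h' => h.elim h'.1.2.nonempty.some) id
    rw [hset, finprod_mem_empty, realizerRatio_of_subsingleton L fun u => h.elim u]
  · have h1 := realizerRatio_induced_eq_finprod hco hG L Set.univ isStrongModule_univ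
      Set.univ_nonempty
    have e : (inducedDigraph D Set.univ).Adj ≃r D.Adj := ⟨Equiv.Set.univ V, Iff.rfl⟩
    simpa [realizerRatio_congr e] using h1

end Count

/-! ### Assembling the count of the geo-equivalence class -/

theorem permGraph_adj {n : ℕ} (π : Equiv.Perm (Fin n)) (u v : Fin n) :
    (permGraph π).Adj u v ↔ (permDigraph π).Adj u v ∨ (permDigraph π).Adj v u := by
  rw [permGraph, SimpleGraph.fromRel_adj]
  refine and_iff_right_of_imp ?_
  rintro (h | h) rfl
  · exact lt_irrefl _ h.1
  · exact lt_irrefl _ h.1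

theorem ncard_represents_inv {n : ℕ} (D : Digraph (Fin n)) :
    {σ : Equiv.Perm (Fin n) | Represents D σ⁻¹}.ncard =
      {σ : Equiv.Perm (Fin n) | Represents D σ}.ncard :=
  Set.ncard_congr (fun σ _ => σ⁻¹) (fun _ h => h) (fun _ _ _ _ h => inv_injective h)
    fun σ h => ⟨σ⁻¹, by simpa using h, inv_inv σ⟩

/-- Inverting `σ` reverses `D(σ)`, so the inverses of the permutations represented by `D` are those
represented by `-D`. -/
theorem represents_inv_iff {n : ℕ} {D : Digraph (Fin n)} {σ : Equiv.Perm (Fin n)} :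
    Represents D σ⁻¹ ↔ DigraphIsomorphic (reverseDigraph D) (permDigraph σ) :=
  ⟨fun h => DigraphIsomorphic.trans h.reverse (digraphIsomorphic_inv σ).symm,
    fun h => DigraphIsomorphic.trans h.reverse (digraphIsomorphic_inv σ).reverse⟩

end GeoPerm

theorem mainTheorem7 {n : ℕ} (T : GeoPerm.Template n) (π : Equiv.Perm (Fin n))
    (hG : GeoPerm.IsCograph (GeoPerm.permGraph π)) :
    let G := GeoPerm.permGraph π
    let D := GeoPerm.permDigraph π
    let nD : ℕ := {σ : Equiv.Perm (Fin n) | GeoPerm.Represents D σ}.ncard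
    (nD : ℚ) = ∏ᶠ M ∈ {M : Set (Fin n) | GeoPerm.IsZeroNode G M}, GeoPerm.nodeFactor G D M ∧
    (¬ GeoPerm.DigraphIsomorphic D (GeoPerm.reverseDigraph D) →
      (GeoPerm.geoClass T π).ncard = 2 * nD) ∧
    (GeoPerm.DigraphIsomorphic D (GeoPerm.reverseDigraph D) →
      (GeoPerm.geoClass T π).ncard = nD) := by
  intro G D nD
  refine ⟨?_, fun h => ?_, fun h => ?_⟩
  · rw [← GeoPerm.realizerRatio_eq_ncard (Nat.card_fin n) D]
    exact GeoPerm.realizerRatio_eq_finprod hG (GeoPerm.permGraph_adj π)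
      (GeoPerm.realizerOfIso π (RelIso.refl _))
  · rw [GeoPerm.geoClass_eq_union, Set.ncard_union_eq _ (Set.toFinite _) (Set.toFinite _),
      GeoPerm.ncard_represents_inv, two_mul]
    -- A common `σ` would give `D ≅ D(σ) ≅ -D`.
    refine Set.disjoint_left.2 fun σ h1 h2 => h ?_
    exact GeoPerm.DigraphIsomorphic.trans h1 (GeoPerm.represents_inv_iff.1 h2).symm
  · rw [GeoPerm.geoClass_eq_union]
    have hset : {σ : Equiv.Perm (Fin n) | GeoPerm.Represents D σ⁻¹} =
        {σ | GeoPerm.Represents D σ} := by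
      ext σ
      exact GeoPerm.represents_inv_iff.trans ⟨h.trans, h.symm.trans⟩
    rw [hset, Set.union_self]
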